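/- **Setting.** Graphs are finite, simple and undirected, with node set $\{1,\dots,N\}$; $S\in\{0,1\}^{N\times N}$ is the adjacency matrix. Fix an integer $p\ge 2$. A *GNN with power nonlinearity $x\mapsto x^p$* is a composition of finitely many (at least one) layers $$X^{(l)}=\sigma_l\Big(\sum_{k=0}^{1} S^k X^{(l-1)} H^{(l)}_k\Big),$$ where $X^{(l)}\in\mathbb R^{N\times F_l}$, the $H^{(l)}_k$ are real matrices, and $\sigma_l$ acts on each row (node) separately as a multi-layer perceptron with one hidden layer and activation $x\mapsto x^p$, that is, $\sigma_l(z)=(zW_1+b_1)^{p}\,W_2+b_2$ with the power taken entrywise. The parameters (number of layers, widths, matrices $H^{(l)}_k,W_1,W_2$, vectors $b_1,b_2$) do not depend on the graph or on $N$. For a node signal $x\in\mathbb R^N$, used as input $X^{(0)}=x$ (so $F_0=1$), the output is $\Phi(\mathcal G,x)\in\mathbb R^{N\times F_L}$, where $L$ is the number of layers. For a node $v$ let $c_k(\mathcal G,v)$ be the number of cycles with $k$ nodes that contain $v$, i.e. of (not necessarily induced) subgraphs of $\mathcal G$ that contain $v$ and are isomorphic to the $k$-cycle. **Statement (Structure Counting).**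 Let $p\ge2$ be an integer. 1. Let $\mu$ be a probability distribution on $\mathbb R$ with all moments finite, mean $0$ and variance $1$. There is a GNN $\Phi$ with nonlinearity $x\mapsto x^p$ and output dimension $5$ such that for every $N$, every graph $\mathcal G$ on $N$ nodes, and all i.i.d. random variables $q=(q_1,\dots,q_N)$ with distribution $\mu$, the output $\Phi(\mathcal G,q)$ is integrable and $$\mathbb E\big[\Phi(\mathcal G,q)\big]_{v,\cdot}=\big(c_3(\mathcal G,v),c_4(\mathcal G,v),c_5(\mathcal G,v),c_6(\mathcal G,v),c_7(\mathcal G,v)\big)\qquad\text{for every node }v.$$ 2. There is a GNN $\Psi$ with nonlinearity $x\mapsto x^p$ and output dimension $5$ such that for every $N$ and every graph $\mathcal G$ on $N$ nodes, with $e_1,\dots,e_N$ the standard basis vectors of $\mathbb R^N$, $$\sum_{m=1}^N\Psi(\mathcal G,e_m)_{v,\cdot}=\big(c_3(\mathcal G,v),c_4(\mathcal G,v),c_5(\mathcal G,v),c_6(\mathcal G,v),c_7(\mathcal G,v)\big)\qquad\text{for every node }v.$$ -/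

import Mathlib

open MeasureTheory ProbabilityTheory

noncomputable section

/-- A perceptron with one hidden layer of width `h`, input dimension `m` and output dimension `n`,
acting on the feature vector of a single node. Its activation function is `x ↦ x ^ p`. -/
structure PowerMLP (p m n : ℕ) where
  h : ℕ
  W₁ : Matrix (Fin m) (Fin h) ℝ
  b₁ : Fin h → ℝ
  W₂ : Matrix (Fin h) (Fin n) ℝ
  b₂ : Fin n → ℝ

/-- `z ↦ (z W₁ + b₁)^p W₂ + b₂`, where the power is taken entry by entry. -/
def PowerMLP.apply {p m n : ℕ} (σ : PowerMLP p m n) (z : Fin m → ℝ) : Fin n → ℝ :=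
  fun j => ∑ a, (∑ i, z i * σ.W₁ i a + σ.b₁ a) ^ p * σ.W₂ a j + σ.b₂ j

/-- The parameters of one message-passing layer with `K = 2` filter taps. -/
structure GNNLayer (p m n : ℕ) where
  d : ℕ
  H : Fin 2 → Matrix (Fin m) (Fin d) ℝ
  σ : PowerMLP p d n

/-- `X ↦ σ (∑_{k < 2} S^k X H_k)`, where `σ` acts on each row (that is, on each node) separately. -/
def GNNLayer.apply {p m n : ℕ} (L : GNNLayer p m n) {V : Type*} [Fintype V] [DecidableEq V]
    (S : Matrix V V ℝ) (X : Matrix V (Fin m) ℝ) : Matrix V (Fin n) ℝ :=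
  Matrix.of fun v => L.σ.apply ((∑ k : Fin 2, S ^ (k : ℕ) * X * L.H k) v)

/-- The parameters of a graph neural network: one or more layers of matching dimensions. They do
not refer to any graph. -/
inductive GNN (p m : ℕ) : ℕ → Type
  | single {n : ℕ} (L : GNNLayer p m n) : GNN p m n
  | snoc {d n : ℕ} (Φ : GNN p m d) (L : GNNLayer p d n) : GNN p m n

/-- The output of the network on the graph with shift operator `S` and node features `X`. -/
def GNN.apply {p m : ℕ} {V : Type*} [Fintype V] [DecidableEq V] (S : Matrix V V ℝ)
    (X : Matrix V (Fin m) ℝ) : {n : ℕ} → GNN p m n → Matrix V (Fin n) ℝ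
  | _, .single L => L.apply S X
  | _, .snoc Φ L => L.apply S (GNN.apply S X Φ)

/-- `Φ(G, x)`: the network run on the graph `G` with its adjacency matrix as shift operator and
with the scalar node signal `x`. -/
def GNN.run {p n : ℕ} (Φ : GNN p 1 n) {V : Type*} [Fintype V] [DecidableEq V]
    (G : SimpleGraph V) [DecidableRel G.Adj] (x : V → ℝ) : Matrix V (Fin n) ℝ :=
  Φ.apply (G.adjMatrix ℝ) (Matrix.of fun v _ => x v)

/-- The number of cycles with `k` nodes in `G` that pass through `v`: the number of subgraphs of
`G`, not necessarily induced, that contain `v` and are isomorphic to the `k`-cycle. -/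
def cycleCount {V : Type*} (G : SimpleGraph V) (k : ℕ) (v : V) : ℕ :=
  {C : G.Subgraph | v ∈ C.verts ∧ Nonempty (C.coe ≃g SimpleGraph.cycleGraph k)}.ncard

end

/-! Networks with a `p`-th power nonlinearity compute every node-wise polynomial in the signal that
is built from sums, products and shifts (`realizable_of_two_le`): for `p ≥ 2` the `p`-th powers of
affine forms span all coordinates and products of two coordinates. It remains to find such
polynomials whose mean, or whose sum over basis vectors, is the cycle count. Both operations are
treated as linear functionals on polynomials in the signal.

A cycle through `v` is traced by exactly two injective closed walks from `v` (`two_mul_cycleCount`).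
Inclusion-exclusion over coincidences of positions (`attainable_injective_walks`) reduces injective
walks to rooted homomorphisms from quotients of the `k`-cycle. In such a quotient a spanning tree is
chosen. Summing over its placements is message passing (`exists_nodeProg_treeSum`), so only the
edges outside the tree need the functional.

With basis vectors, any set of extra edges with a common end can be tested: the input marks that
end, and its shift reads off adjacency to it (`soundRule_starRule`). With random signals, one extra
edge is the covariance of `q` at one end and `S q` at the other. Two edges need a fourth moment, in
which the tree edges turn the unwanted pairings into attainable terms (`treeAttainable_edge_pair`).
Three triangles on a common edge need a sixth moment (`momentFunctional_X_mul_sq_mul_cube`), again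
with attainable corrections; these cases give `soundRule_pairRule`. A finite computation checks that
for `3 ≤ k ≤ 7` every quotient without loops has a suitable presentation, while those with loops
contribute nothing. -/

/-! ### Node programs -/

/-- Node-wise polynomial programs on a graph: generated by the constant `1` and the input signal
under linear combinations, entrywise products and applications of the shift operator. -/
inductive NodeProg : Type
  | one : NodeProg
  | input : NodeProg
  | add : NodeProg → NodeProg → NodeProg
  | smul : ℝ → NodeProg → NodeProg
  | mul : NodeProg → NodeProg → NodeProg
  | shift : NodeProg → NodeProg

/-- The value of a program on the signal `q` with values in a commutative `ℝ`-algebra. -/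
def NodeProg.eval {V A : Type*} [Fintype V] [CommRing A] [Algebra ℝ A] (S : Matrix V V ℝ)
    (q : V → A) : NodeProg → V → A
  | .one, _ => 1
  | .input, v => q v
  | .add P Q, v => P.eval S q v + Q.eval S q v
  | .smul r P, v => r • P.eval S q v
  | .mul P Q, v => P.eval S q v * Q.eval S q v
  | .shift P, v => ∑ w, S v w • P.eval S q w

/-- This permits running a program once on the generic signal of polynomial variables and
specializing afterwards. -/
theorem NodeProg.map_eval {V A B : Type*} [Fintype V] [CommRing A] [Algebra ℝ A] [CommRing B]
    [Algebra ℝ B] (φ : A →ₐ[ℝ] B) (S : Matrix V V ℝ) (q : V → A) (P : NodeProg) (v : V) :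
    φ (P.eval S q v) = P.eval S (fun w => φ (q w)) v := by
  induction P generalizing v with
  | one => simp [eval]
  | input => simp [eval]
  | add P Q hP hQ => simp [eval, hP, hQ]
  | smul r P hP => simp [eval, hP]
  | mul P Q hP hQ => simp [eval, hP, hQ]
  | shift P hP => simp [eval, hP]

/-! ### Linear and quadratic functions as combinations of `p`-th powers -/

/-- The functions of a vector `z : ℝ^d` spanned by the `p`-th powers of affine forms. -/
def powerSpan (p d : ℕ) : Submodule ℝ ((Fin d → ℝ) → ℝ) :=
  Submodule.span ℝ (Set.range fun w : (Fin d → ℝ) × ℝ => fun z => (∑ i, z i * w.1 i + w.2) ^ p)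

theorem exists_sum_shifted_pow (p k : ℕ) (hk : k ≤ p) :
    ∃ c : Fin (p + 1) → ℝ, ∀ t : ℝ, ∑ b, c b * (t + (b : ℕ)) ^ p = t ^ k := by
  let A : Matrix (Fin (p + 1)) (Fin (p + 1)) ℝ :=
    (Matrix.vandermonde fun b : Fin (p + 1) => ((b : ℕ) : ℝ)).transpose
  have hA : IsUnit A.det := by
    rw [Matrix.det_transpose, isUnit_iff_ne_zero, Matrix.det_vandermonde_ne_zero_iff]
    intro a b h
    exact Fin.ext (Nat.cast_injective (R := ℝ) h)
  -- In the binomial expansion, `t ^ m` carries `p.choose m` times the moment of order `p - m` of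
  -- the weights `c`. Prescribing these moments by `y` leaves only `t ^ k`; the Vandermonde system
  -- at the nodes `0, …, p` is solvable.
  let y : Fin (p + 1) → ℝ := fun j => if (j : ℕ) = p - k then ((p.choose k : ℕ) : ℝ)⁻¹ else 0
  refine ⟨A⁻¹.mulVec y, fun t => ?_⟩
  have hc : ∀ j : Fin (p + 1), ∑ b, (A⁻¹.mulVec y) b * ((b : ℕ) : ℝ) ^ (j : ℕ) = y j := by
    intro j
    have h : A.mulVec (A⁻¹.mulVec y) = y := by
      rw [Matrix.mulVec_mulVec, Matrix.mul_nonsing_inv _ hA, Matrix.one_mulVec]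
    have h' := congrFun h j
    rw [← h']
    simp [Matrix.mulVec, dotProduct, A, Matrix.vandermonde_apply, mul_comm]
  generalize A⁻¹.mulVec y = c at hc
  have hch : ((p.choose k : ℕ) : ℝ) ≠ 0 := by
    exact_mod_cast (Nat.choose_pos hk).ne'
  calc ∑ b, c b * (t + (b : ℕ)) ^ p
      = ∑ b, ∑ m ∈ Finset.range (p + 1),
          t ^ m * (p.choose m) * (c b * ((b : ℕ) : ℝ) ^ (p - m)) := by
        refine Finset.sum_congr rfl fun b _ => ?_
        rw [add_pow, Finset.mul_sum]
        exact Finset.sum_congr rfl fun m _ => by ring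
    _ = ∑ m ∈ Finset.range (p + 1), t ^ m * (p.choose m) *
          ∑ b, c b * ((b : ℕ) : ℝ) ^ (p - m) := by
        rw [Finset.sum_comm]
        simp_rw [Finset.mul_sum]
    _ = ∑ m ∈ Finset.range (p + 1), if m = k then t ^ k else 0 := by
        refine Finset.sum_congr rfl fun m hm => ?_
        have hm' : m ≤ p := Nat.lt_succ_iff.mp (Finset.mem_range.mp hm)
        have := hc ⟨p - m, by omega⟩
        simp only [y] at this
        rw [this]
        by_cases h : m = k
        · subst h
          simp [hch]
        · rw [if_neg (by omega), if_neg h, mul_zero]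
    _ = t ^ k := by simp [hk]

theorem affine_pow_mem_powerSpan {p d k : ℕ} (hk : k ≤ p) (w : Fin d → ℝ) (b : ℝ) :
    (fun z => (∑ i, z i * w i + b) ^ k) ∈ powerSpan p d := by
  obtain ⟨c, hc⟩ := exists_sum_shifted_pow p k hk
  have : (fun z : Fin d → ℝ => (∑ i, z i * w i + b) ^ k) =
      ∑ a, c a • fun z : Fin d → ℝ => (∑ i, z i * w i + (b + (a : ℕ))) ^ p := by
    funext z
    rw [← hc, Finset.sum_apply]
    simp [add_assoc]
  rw [this]
  exact Submodule.sum_mem _ fun a _ => Submodule.smul_mem _ _ (Submodule.subset_span ⟨(w, _), rfl⟩)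

theorem one_mem_powerSpan (p d : ℕ) : (fun _ => 1) ∈ powerSpan p d := by
  simpa using affine_pow_mem_powerSpan (p := p) (d := d) (Nat.zero_le p) 0 0

theorem coord_mem_powerSpan {p d : ℕ} (hp : 1 ≤ p) (i : Fin d) :
    (fun z => z i) ∈ powerSpan p d := by
  have := affine_pow_mem_powerSpan hp (Pi.single i 1) 0
  simpa [Pi.single_apply] using this

/-- Polarization: a product is half of the square of the sum minus the two squares. This is where `2
≤ p` is needed. -/
theorem coord_mul_coord_mem_powerSpan {p d : ℕ} (hp : 2 ≤ p) (i j : Fin d) :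
    (fun z => z i * z j) ∈ powerSpan p d := by
  have h₁ := affine_pow_mem_powerSpan hp (Pi.single i 1 + Pi.single j 1) 0
  have h₂ := affine_pow_mem_powerSpan hp (Pi.single i 1) 0
  have h₃ := affine_pow_mem_powerSpan hp (Pi.single j 1) 0
  have h := Submodule.smul_mem _ (1 / 2 : ℝ) (sub_mem (sub_mem h₁ h₂) h₃)
  convert h using 1
  funext z
  simp [Pi.single_apply, mul_add, Finset.sum_add_distrib]
  ring

theorem exists_powerMLP_of_mem_powerSpan {p d n : ℕ} (f : Fin n → (Fin d → ℝ) → ℝ)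
    (hf : ∀ j, f j ∈ powerSpan p d) : ∃ σ : PowerMLP p d n, ∀ z j, σ.apply z j = f j z := by
  have key : ∀ j, ∃ (h : ℕ) (w : Fin h → (Fin d → ℝ) × ℝ) (c : Fin h → ℝ), ∀ z,
      ∑ a, (∑ i, z i * (w a).1 i + (w a).2) ^ p * c a = f j z := by
    intro j
    refine Submodule.span_induction (p := fun g _ => ∃ (h : ℕ) (w : Fin h → (Fin d → ℝ) × ℝ)
      (c : Fin h → ℝ), ∀ z, ∑ a, (∑ i, z i * (w a).1 i + (w a).2) ^ p * c a = g z)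
      ?_ ?_ ?_ ?_ (hf j)
    · rintro _ ⟨w, rfl⟩
      exact ⟨1, fun _ => w, fun _ => 1, fun z => by simp⟩
    · exact ⟨0, Fin.elim0, Fin.elim0, fun z => by simp⟩
    · rintro g g' _ _ ⟨h, w, c, H⟩ ⟨h', w', c', H'⟩
      refine ⟨h + h', Fin.append w w', Fin.append c c', fun z => ?_⟩
      rw [Fin.sum_univ_add]
      simp [H, H']
    · rintro r g _ ⟨h, w, c, H⟩
      refine ⟨h, w, fun a => r * c a, fun z => ?_⟩
      simp only [Pi.smul_apply, smul_eq_mul, ← H, Finset.mul_sum]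
      exact Finset.sum_congr rfl fun a _ => by ring
  choose h w c H using key
  -- The hidden layers of the separate outputs are put side by side; `W₂` is block diagonal.
  let e := (finSigmaFinEquiv (m := n) (n := h)).symm
  refine ⟨⟨∑ j, h j, Matrix.of fun i a => (w (e a).1 (e a).2).1 i,
    fun a => (w (e a).1 (e a).2).2,
    Matrix.of fun a j => if (e a).1 = j then c (e a).1 (e a).2 else 0, 0⟩, fun z j => ?_⟩
  simp only [PowerMLP.apply, Matrix.of_apply, Pi.zero_apply, add_zero]
  rw [← H j z, Equiv.sum_comp e (fun s : (j : Fin n) × Fin (h j) =>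
    (∑ i, z i * (w s.1 s.2).1 i + (w s.1 s.2).2) ^ p * if s.1 = j then c s.1 s.2 else 0),
    Fintype.sum_sigma, Finset.sum_eq_single j]
  · simp
  · intro b _ hb
    simp [hb]
  · simp

/-! ### Networks that compute programs -/

/-- The two filter taps embed `X` and `S X` into disjoint blocks of features, so the perceptron sees
both at each node. -/
theorem exists_gnnLayer {p m n : ℕ} (f : Fin n → (Fin (m + m) → ℝ) → ℝ)
    (hf : ∀ j, f j ∈ powerSpan p (m + m)) :
    ∃ L : GNNLayer p m n, ∀ (N : ℕ) (S : Matrix (Fin N) (Fin N) ℝ) (X : Matrix (Fin N) (Fin m) ℝ)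
      (v : Fin N) (j : Fin n),
      L.apply S X v j = f j (Fin.append (fun i => X v i) fun i => ∑ w, S v w * X w i) := by
  obtain ⟨σ, hσ⟩ := exists_powerMLP_of_mem_powerSpan f hf
  refine ⟨⟨m + m, ![Matrix.of fun i a => Fin.append (fun a' => if i = a' then 1 else 0)
    (fun _ => 0) a, Matrix.of fun i a => Fin.append (fun _ => 0)
    (fun a' => if i = a' then 1 else 0) a], σ⟩, fun N S X v j => ?_⟩
  simp only [GNNLayer.apply, Matrix.of_apply, hσ]
  congr 1
  funext a
  refine Fin.addCases (fun a => ?_) (fun a => ?_) a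
  · simp [Fin.sum_univ_two, Matrix.mul_apply]
  · simp [Fin.sum_univ_two, Matrix.mul_apply, -Fin.natAdd_eq_addNat]

/-- A family of programs is realizable if a single network outputs the values of all of them. -/
def Realizable (p : ℕ) {n : ℕ} (P : Fin n → NodeProg) : Prop :=
  ∃ Φ : GNN p 1 n, ∀ (N : ℕ) (S : Matrix (Fin N) (Fin N) ℝ) (x : Fin N → ℝ) (v : Fin N)
    (j : Fin n), Φ.apply S (Matrix.of fun v _ => x v) v j = (P j).eval S x v

/-- `P` is obtained from the members of `l` by at most one operation. -/
inductive OneStep (l : List NodeProg) : NodeProg → Prop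
  | mem {P} : P ∈ l → OneStep l P
  | one : OneStep l .one
  | add {P Q} : P ∈ l → Q ∈ l → OneStep l (.add P Q)
  | smul {P} (r : ℝ) : P ∈ l → OneStep l (.smul r P)
  | mul {P Q} : P ∈ l → Q ∈ l → OneStep l (.mul P Q)
  | shift {P} : P ∈ l → OneStep l (.shift P)

theorem OneStep.exists_powerSpan {p : ℕ} (hp : 2 ≤ p) {l : List NodeProg} {P : NodeProg}
    (h : OneStep l P) : ∃ f ∈ powerSpan p (l.length + l.length),
      ∀ (N : ℕ) (S : Matrix (Fin N) (Fin N) ℝ) (x : Fin N → ℝ) (v : Fin N),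
        f (Fin.append (fun i => (l.get i).eval S x v)
          fun i => ∑ w, S v w * (l.get i).eval S x w) = P.eval S x v := by
  have h1 : 1 ≤ p := by omega
  cases h with
  | mem h =>
    obtain ⟨i, rfl⟩ := List.get_of_mem h
    exact ⟨_, coord_mem_powerSpan h1 (Fin.castAdd _ i), fun N S x v => by simp⟩
  | one => exact ⟨_, one_mem_powerSpan _ _, fun N S x v => by simp [NodeProg.eval]⟩
  | add h h' =>
    obtain ⟨i, rfl⟩ := List.get_of_mem h
    obtain ⟨j, rfl⟩ := List.get_of_mem h'
    exact ⟨_, add_mem (coord_mem_powerSpan h1 (Fin.castAdd _ i))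
      (coord_mem_powerSpan h1 (Fin.castAdd _ j)), fun N S x v => by simp [NodeProg.eval]⟩
  | smul r h =>
    obtain ⟨i, rfl⟩ := List.get_of_mem h
    exact ⟨_, Submodule.smul_mem _ r (coord_mem_powerSpan h1 (Fin.castAdd _ i)),
      fun N S x v => by simp [NodeProg.eval]⟩
  | mul h h' =>
    obtain ⟨i, rfl⟩ := List.get_of_mem h
    obtain ⟨j, rfl⟩ := List.get_of_mem h'
    exact ⟨_, coord_mul_coord_mem_powerSpan hp (Fin.castAdd _ i) (Fin.castAdd _ j),
      fun N S x v => by simp [NodeProg.eval]⟩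
  | shift h =>
    obtain ⟨i, rfl⟩ := List.get_of_mem h
    exact ⟨_, coord_mem_powerSpan h1 (Fin.natAdd _ i), fun N S x v => by
      simp [NodeProg.eval, -Fin.natAdd_eq_addNat]⟩

theorem Realizable.step {p n : ℕ} (hp : 2 ≤ p) {l : List NodeProg} {P : Fin n → NodeProg}
    (hl : Realizable p l.get) (h : ∀ j, OneStep l (P j)) : Realizable p P := by
  obtain ⟨Φ, hΦ⟩ := hl
  choose f hf hfe using fun j => (h j).exists_powerSpan hp
  obtain ⟨L, hL⟩ := exists_gnnLayer f hf
  refine ⟨.snoc Φ L, fun N S x v j => ?_⟩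
  rw [GNN.apply, hL, ← hfe]
  simp only [hΦ]

theorem realizable_input {p : ℕ} (hp : 2 ≤ p) : Realizable p [NodeProg.input].get := by
  obtain ⟨L, hL⟩ := exists_gnnLayer (p := p) (m := 1) (n := 1)
    (fun _ z => z (Fin.castAdd 1 0)) fun _ => coord_mem_powerSpan (by omega) _
  refine ⟨.single L, fun N S x v j => ?_⟩
  rw [GNN.apply, hL, Fin.append_left]
  fin_cases j
  simp [NodeProg.eval]

/-- Each new layer copies all features held so far and appends one. The input has to be among them,
since later layers have no other access to it. -/
theorem Realizable.exists_extend {p : ℕ} (hp : 2 ≤ p) (P : NodeProg) {l : List NodeProg}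
    (hl : Realizable p l.get) (hi : NodeProg.input ∈ l) :
    ∃ l' : List NodeProg, Realizable p l'.get ∧ l ⊆ l' ∧ P ∈ l' := by
  have cons : ∀ {l : List NodeProg} {Q}, Realizable p l.get → OneStep l Q →
      Realizable p (Q :: l).get := by
    intro l Q h hQ
    refine h.step hp fun j => ?_
    rcases List.mem_cons.mp (List.get_mem (Q :: l) j) with hj | hj
    · rw [hj]
      exact hQ
    · exact .mem hj
  induction P generalizing l with
  | one => exact ⟨_, cons hl .one, List.subset_cons_self _ _, List.mem_cons_self⟩
  | input => exact ⟨l, hl, List.Subset.refl _, hi⟩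
  | add P Q hP hQ =>
    obtain ⟨l₁, h₁, hs₁, m₁⟩ := hP hl hi
    obtain ⟨l₂, h₂, hs₂, m₂⟩ := hQ h₁ (hs₁ hi)
    exact ⟨_, cons h₂ (.add (hs₂ m₁) m₂),
      fun _ h => List.mem_cons_of_mem _ (hs₂ (hs₁ h)), List.mem_cons_self⟩
  | smul r P hP =>
    obtain ⟨l₁, h₁, hs₁, m₁⟩ := hP hl hi
    exact ⟨_, cons h₁ (.smul r m₁),
      fun _ h => List.mem_cons_of_mem _ (hs₁ h), List.mem_cons_self⟩
  | mul P Q hP hQ =>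
    obtain ⟨l₁, h₁, hs₁, m₁⟩ := hP hl hi
    obtain ⟨l₂, h₂, hs₂, m₂⟩ := hQ h₁ (hs₁ hi)
    exact ⟨_, cons h₂ (.mul (hs₂ m₁) m₂),
      fun _ h => List.mem_cons_of_mem _ (hs₂ (hs₁ h)), List.mem_cons_self⟩
  | shift P hP =>
    obtain ⟨l₁, h₁, hs₁, m₁⟩ := hP hl hi
    exact ⟨_, cons h₁ (.shift m₁),
      fun _ h => List.mem_cons_of_mem _ (hs₁ h), List.mem_cons_self⟩

/-- Every tuple of node programs is computed by a network whose nonlinearity is a `p`-th power. -/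
theorem realizable_of_two_le {p n : ℕ} (hp : 2 ≤ p) (P : Fin n → NodeProg) : Realizable p P := by
  have key : ∀ l : List NodeProg, ∃ l' : List NodeProg,
      Realizable p l'.get ∧ NodeProg.input ∈ l' ∧ l ⊆ l' := by
    intro l
    induction l with
    | nil => exact ⟨_, realizable_input hp, List.mem_singleton_self _, List.nil_subset _⟩
    | cons P l ih =>
      obtain ⟨l₁, h₁, hi₁, hs₁⟩ := ih
      obtain ⟨l₂, h₂, hs₂, m₂⟩ := h₁.exists_extend hp P hi₁
      exact ⟨l₂, h₂, hs₂ hi₁, List.cons_subset.mpr ⟨m₂, fun _ h => hs₂ (hs₁ h)⟩⟩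
  obtain ⟨l', h', -, hs⟩ := key (List.ofFn P)
  exact h'.step hp fun j => .mem (hs (List.mem_ofFn.mpr ⟨j, rfl⟩))

/-! ### Sums over placements of a tree -/

/-- The edges of the rooted tree on `0, 1, 2, …` in which the vertices `i, i + 1, …` have the listed
parents. -/
def treeEdges : ℕ → List ℕ → List (ℕ × ℕ)
  | _, [] => []
  | i, p :: ps => (p, i) :: treeEdges (i + 1) ps

/-- Every vertex of the tree has a parent that is smaller than itself. -/
def parentsValid : ℕ → List ℕ → Bool
  | _, [] => true
  | i, p :: ps => p.blt i && parentsValid (i + 1) ps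

/-- The sum of `φ` over all extensions of the vertex map `x` to the new tree vertices `i, i + 1, …`,
each weighted by the product of the entries of `S` along the tree edges. -/
def treeSum {V M : Type*} [Fintype V] [AddCommMonoid M] [Module ℝ M] (S : Matrix V V ℝ) :
    List ℕ → ℕ → (ℕ → V) → ((ℕ → V) → M) → M
  | [], _, x, φ => φ x
  | p :: ps, i, x, φ => ∑ y, S (x p) y • treeSum S ps (i + 1) (Function.update x i y) φ

section treeSum

variable {V M : Type*} [Fintype V] [AddCommMonoid M] [Module ℝ M] (S : Matrix V V ℝ)

theorem treeSum_add (par : List ℕ) (i : ℕ) (x : ℕ → V) (φ ψ : (ℕ → V) → M) :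
    treeSum S par i x (fun x => φ x + ψ x) = treeSum S par i x φ + treeSum S par i x ψ := by
  induction par generalizing i x with
  | nil => rfl
  | cons p ps ih => simp [treeSum, ih, Finset.sum_add_distrib]

theorem treeSum_smul (par : List ℕ) (i : ℕ) (x : ℕ → V) (r : ℝ) (φ : (ℕ → V) → M) :
    treeSum S par i x (fun x => r • φ x) = r • treeSum S par i x φ := by
  induction par generalizing i x with
  | nil => rfl
  | cons p ps ih => simp [treeSum, ih, Finset.smul_sum, smul_comm r]

theorem map_treeSum {M' : Type*} [AddCommMonoid M'] [Module ℝ M'] (L : M →ₗ[ℝ] M') (par : List ℕ)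
    (i : ℕ) (x : ℕ → V) (φ : (ℕ → V) → M) :
    L (treeSum S par i x φ) = treeSum S par i x fun x => L (φ x) := by
  induction par generalizing i x with
  | nil => rfl
  | cons p ps ih => simp [treeSum, ih]

variable {S}

/-- The other placements have weight zero. Later arguments may therefore use that tree edges are
mapped to edges. -/
theorem treeSum_congr (hS : S.IsAdjMatrix) {par : List ℕ} {i : ℕ} (hpar : parentsValid i par)
    {x : ℕ → V} {φ ψ : (ℕ → V) → M}
    (h : ∀ z : ℕ → V, (∀ j < i, z j = x j) →
      (∀ e ∈ treeEdges i par, S (z e.1) (z e.2) = 1) → φ z = ψ z) :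
    treeSum S par i x φ = treeSum S par i x ψ := by
  induction par generalizing i x with
  | nil => exact h x (fun _ _ => rfl) (by simp [treeEdges])
  | cons p ps ih =>
    simp only [parentsValid, Bool.and_eq_true, Nat.blt_eq] at hpar
    simp only [treeSum]
    refine Finset.sum_congr rfl fun y _ => ?_
    rcases hS.zero_or_one (x p) y with h0 | h1
    · simp [h0]
    · congr 1
      refine ih hpar.2 fun z hz he => h z (fun j hj => ?_) fun e hmem => ?_
      · rw [hz j (by omega), Function.update_of_ne (by omega)]
      · rcases List.mem_cons.mp hmem with rfl | hmem
        · rw [hz p (by omega), hz i (by omega), Function.update_of_ne (by omega)]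
          simpa using h1
        · exact he e hmem

end treeSum

/-- The last vertex is a leaf: summing over its position shifts its program to the parent, where it
is multiplied in. Repeating this moves everything to the vertices below `i`. -/
theorem exists_nodeProg_treeSum {par : List ℕ} {i : ℕ} (hpar : parentsValid i par)
    (g : ℕ → NodeProg) : ∃ g' : ℕ → NodeProg,
      ∀ {V A : Type} [Fintype V] [CommRing A] [Algebra ℝ A] (S : Matrix V V ℝ) (q : V → A)
        (x : ℕ → V),
        treeSum S par i x (fun x => ∏ j ∈ Finset.range (i + par.length), (g j).eval S q (x j)) =
          ∏ j ∈ Finset.range i, (g' j).eval S q (x j) := by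
  induction par generalizing i with
  | nil => exact ⟨g, fun S q x => rfl⟩
  | cons p ps ih =>
    simp only [parentsValid, Bool.and_eq_true, Nat.blt_eq] at hpar
    obtain ⟨g', hg'⟩ := ih hpar.2
    refine ⟨Function.update g' p ((g' p).mul (g' i).shift), fun {V A} _ _ _ S q x => ?_⟩
    have e : i + (p :: ps).length = i + 1 + ps.length := by simp; omega
    have hp : p ∈ Finset.range i := Finset.mem_range.mpr hpar.1
    simp only [treeSum, e, hg', Finset.prod_range_succ, Function.update_self]
    have h : ∀ y, ∏ j ∈ Finset.range i, (g' j).eval S q (Function.update x i y j) =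
        ∏ j ∈ Finset.range i, (g' j).eval S q (x j) := fun y =>
      Finset.prod_congr rfl fun j hj => by
        rw [Function.update_of_ne (Finset.mem_range.mp hj).ne]
    simp only [h, ← mul_smul_comm, ← Finset.mul_sum]
    have h' : ∀ P : NodeProg, ∏ j ∈ (Finset.range i).erase p,
        (Function.update g' p P j).eval S q (x j) =
        ∏ j ∈ (Finset.range i).erase p, (g' j).eval S q (x j) := fun P =>
      Finset.prod_congr rfl fun j hj => by
        rw [Function.update_of_ne (Finset.ne_of_mem_erase hj)]
    rw [← Finset.mul_prod_erase _ _ hp, ← Finset.mul_prod_erase _ _ hp, Function.update_self, h']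
    simp only [NodeProg.eval]
    ring

theorem exists_nodeProg_slots (n : ℕ) (sl : List (ℕ × NodeProg)) (h : ∀ s ∈ sl, s.1 < n) :
    ∃ g : ℕ → NodeProg, ∀ {V A : Type} [Fintype V] [CommRing A] [Algebra ℝ A] (S : Matrix V V ℝ)
      (q : V → A) (x : ℕ → V),
        ∏ j ∈ Finset.range n, (g j).eval S q (x j) =
          (sl.map fun s => s.2.eval S q (x s.1)).prod := by
  induction sl with
  | nil => exact ⟨fun _ => .one, fun S q x => by simp [NodeProg.eval]⟩
  | cons s sl ih =>
    obtain ⟨g, hg⟩ := ih fun s hs => h s (List.mem_cons_of_mem _ hs)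
    have hs : s.1 ∈ Finset.range n := Finset.mem_range.mpr (h s List.mem_cons_self)
    refine ⟨Function.update g s.1 (s.2.mul (g s.1)), fun S q x => ?_⟩
    rw [List.map_cons, List.prod_cons, ← hg, ← Finset.mul_prod_erase _ _ hs,
      ← Finset.mul_prod_erase _ (fun j => (g j).eval S q (x j)) hs, Function.update_self]
    rw [Finset.prod_congr rfl fun j hj => by
      rw [Function.update_of_ne (Finset.ne_of_mem_erase hj)]]
    simp only [NodeProg.eval]
    ring

/-! ### Quantities attainable by a linear functional -/

/-- A real-valued quantity attached to the nodes of a graph that is given by its adjacency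
matrix. -/
abbrev NodeFun := ∀ N : ℕ, Matrix (Fin N) (Fin N) ℝ → Fin N → ℝ

/-- A real-valued quantity attached to the maps from the vertices of a tree to a graph. -/
abbrev PlacementFun := ∀ N : ℕ, Matrix (Fin N) (Fin N) ℝ → (ℕ → Fin N) → ℝ

/-- A linear functional on the polynomials in the node signal, for every number of nodes. -/
abbrev SignalFunctional := ∀ N : ℕ, MvPolynomial (Fin N) ℝ →ₗ[ℝ] ℝ

/-- `f` is the value of the functional `L` on the output of some node program. -/
def Attainable (L : SignalFunctional) (f : NodeFun) : Prop :=
  ∃ P : NodeProg, ∀ (N : ℕ) (S : Matrix (Fin N) (Fin N) ℝ), S.IsAdjMatrix →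
    ∀ v, L N (P.eval S MvPolynomial.X v) = f N S v

section Attainable

variable {L : SignalFunctional} {f g : NodeFun}

theorem Attainable.congr (hf : Attainable L f)
    (h : ∀ N S, S.IsAdjMatrix → ∀ v, f N S v = g N S v) : Attainable L g := by
  obtain ⟨P, hP⟩ := hf
  exact ⟨P, fun N S hS v => (hP N S hS v).trans (h N S hS v)⟩

theorem Attainable.add (hf : Attainable L f) (hg : Attainable L g) :
    Attainable L fun N S v => f N S v + g N S v := by
  obtain ⟨P, hP⟩ := hf
  obtain ⟨Q, hQ⟩ := hg
  exact ⟨.add P Q, fun N S hS v => by simp [NodeProg.eval, hP N S hS, hQ N S hS]⟩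

theorem Attainable.smul (hf : Attainable L f) (r : ℝ) :
    Attainable L fun N S v => r * f N S v := by
  obtain ⟨P, hP⟩ := hf
  exact ⟨.smul r P, fun N S hS v => by simp [NodeProg.eval, hP N S hS]⟩

theorem attainable_zero : Attainable L fun _ _ _ => 0 :=
  ⟨.smul 0 .one, fun N S _ v => by simp [NodeProg.eval]⟩

theorem attainable_sum {ι : Type*} (s : Finset ι) {F : ι → NodeFun}
    (h : ∀ i ∈ s, Attainable L (F i)) : Attainable L fun N S v => ∑ i ∈ s, F i N S v := by
  classical
  induction s using Finset.induction_on with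
  | empty => simpa using attainable_zero
  | insert a s ha ih =>
    simp only [Finset.sum_insert ha]
    exact (h a (Finset.mem_insert_self _ _)).add
      (ih fun i hi => h i (Finset.mem_insert_of_mem hi))

/-- The sum of `φ` over all maps of a tree to the graph that send the root `0` to the node `v` is
attainable as a function of `v`. -/
def TreeAttainable (L : SignalFunctional) (par : List ℕ) (φ : PlacementFun) : Prop :=
  Attainable L fun N S v => treeSum S par 1 (fun _ => v) (φ N S)

variable {par : List ℕ} {φ ψ : PlacementFun}

theorem TreeAttainable.congr (hpar : parentsValid 1 par) (hφ : TreeAttainable L par φ)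
    (h : ∀ N S, S.IsAdjMatrix → ∀ x, (∀ e ∈ treeEdges 1 par, S (x e.1) (x e.2) = 1) →
      φ N S x = ψ N S x) : TreeAttainable L par ψ :=
  Attainable.congr hφ fun N S hS _ => treeSum_congr hS hpar fun z _ hz => h N S hS z hz

theorem TreeAttainable.add (hφ : TreeAttainable L par φ) (hψ : TreeAttainable L par ψ) :
    TreeAttainable L par fun N S x => φ N S x + ψ N S x := by
  refine (Attainable.add hφ hψ).congr fun N S _ v => ?_
  rw [treeSum_add]

theorem TreeAttainable.smul (hφ : TreeAttainable L par φ) (r : ℝ) :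
    TreeAttainable L par fun N S x => r * φ N S x := by
  refine (Attainable.smul hφ r).congr fun N S _ v => ?_
  rw [← smul_eq_mul, ← treeSum_smul]
  rfl

/-- The functional is linear, so it commutes with the tree sum, which for a product of vertex
programs is itself one program at the root. -/
theorem treeAttainable_slots (hpar : parentsValid 1 par) (sl : List (ℕ × NodeProg))
    (h : ∀ s ∈ sl, s.1 < par.length + 1) :
    TreeAttainable L par fun N S x =>
      L N (sl.map fun s => s.2.eval S MvPolynomial.X (x s.1)).prod := by
  obtain ⟨g, hg⟩ := exists_nodeProg_slots (1 + par.length) sl (by simpa [add_comm] using h)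
  obtain ⟨g', hg'⟩ := exists_nodeProg_treeSum hpar g
  refine ⟨g' 0, fun N S _ v => ?_⟩
  have := hg' S (MvPolynomial.X (R := ℝ)) (fun _ => v)
  simp only [hg] at this
  simp only [← map_treeSum, this, Finset.prod_range_one]

end Attainable

/-- The product of the entries of `S` along the listed edges. -/
def edgeWeight {V : Type*} (S : Matrix V V ℝ) (E : List (ℕ × ℕ)) (x : ℕ → V) : ℝ :=
  (E.map fun e => S (x e.1) (x e.2)).prod

/-- A criterion for a tree together with additional edges which guarantees that the placements of
the resulting graph can be counted by means of the functional `L`. -/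
def SoundRule (L : SignalFunctional) (rule : List ℕ → List (ℕ × ℕ) → Bool) : Prop :=
  ∀ (par : List ℕ) (ex : List (ℕ × ℕ)), parentsValid 1 par = true →
    (∀ e ∈ ex, e.1 < par.length + 1 ∧ e.2 < par.length + 1) → rule par ex = true →
    TreeAttainable L par fun _ S x => edgeWeight S ex x

/-! ### Extra edges by summation over basis vectors -/

/-- Sum of the values of a polynomial at the standard basis vectors. -/
noncomputable def basisFunctional : SignalFunctional := fun N =>
  ∑ m : Fin N, (MvPolynomial.aeval (Pi.single m (1 : ℝ))).toLinearMap

theorem basisFunctional_apply {N : ℕ} (p : MvPolynomial (Fin N) ℝ) :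
    basisFunctional N p = ∑ m : Fin N, MvPolynomial.aeval (Pi.single m (1 : ℝ)) p := by
  simp [basisFunctional]

/-- The additional edges have a common end vertex. -/
def starRule (_ : List ℕ) (ex : List (ℕ × ℕ)) : Bool :=
  match ex with
  | [] => true
  | e :: es => es.all fun f => f.2.beq e.2

theorem soundRule_starRule : SoundRule basisFunctional starRule := by
  intro par ex hpar hex hrule
  obtain ⟨m, hm, hcommon⟩ : ∃ m < par.length + 1, ∀ e ∈ ex, e.2 = m := by
    cases ex with
    | nil => exact ⟨0, by omega, by simp⟩
    | cons e es =>
      refine ⟨e.2, (hex e List.mem_cons_self).2, ?_⟩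
      simpa [starRule] using hrule
  -- The input at `m` vanishes on every basis vector but the one at `x m`; on that one, the shifted
  -- input at the other end of an extra edge is the entry of `S` for this edge.
  refine (treeAttainable_slots hpar
    ((m, .input) :: ex.map fun e => (e.1, NodeProg.input.shift)) ?_).congr hpar ?_
  · intro s hs
    rcases List.mem_cons.mp hs with rfl | hs
    · exact hm
    · obtain ⟨e, he, rfl⟩ := List.mem_map.mp hs
      exact (hex e he).1
  · intro N S hS x _
    rw [basisFunctional_apply, Finset.sum_eq_single (x m)]
    · have : ∀ e ∈ ex, ∑ w, S (x e.1) w * (Pi.single (x m) (1 : ℝ) : Fin N → ℝ) w =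
          S (x e.1) (x e.2) := by
        intro e he
        rw [hcommon e he]
        simp [Pi.single_apply]
      simp only [edgeWeight, List.map_cons, List.prod_cons, List.map_map, map_mul, map_list_prod,
        Function.comp_def, MvPolynomial.aeval_X, NodeProg.eval, map_sum, map_smul, smul_eq_mul,
        Pi.single_eq_same, one_mul]
      exact congrArg List.prod (List.map_congr_left this)
    · intro y _ hy
      simp only [List.map_cons, List.prod_cons, map_mul, MvPolynomial.aeval_X,
        NodeProg.eval, Pi.single_eq_of_ne hy.symm, zero_mul]
    · simp

/-! ### Moments of independent standardized variables -/

/-- The expectation of a polynomial in independent random variables with the given moments. -/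
noncomputable def momentFunctional (M : ℕ → ℝ) : SignalFunctional := fun N =>
  (MvPolynomial.basisMonomials (Fin N) ℝ).constr ℝ fun s => ∏ i, M (s i)

theorem momentFunctional_monomial (M : ℕ → ℝ) {N : ℕ} (s : Fin N →₀ ℕ) (c : ℝ) :
    momentFunctional M N (MvPolynomial.monomial s c) = c * ∏ i, M (s i) := by
  have h : MvPolynomial.monomial s c = c • MvPolynomial.basisMonomials (Fin N) ℝ s := by
    simp [MvPolynomial.smul_monomial]
  rw [h, map_smul, momentFunctional, Module.Basis.constr_basis, smul_eq_mul]

/-- The first moments of a standardized random variable. -/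
structure IsStandardized (M : ℕ → ℝ) : Prop where
  zero : M 0 = 1
  one : M 1 = 0
  two : M 2 = 1

section moments

variable {M : ℕ → ℝ} {N : ℕ}

open MvPolynomial

theorem momentFunctional_one (hM : IsStandardized M) : momentFunctional M N 1 = 1 := by
  have := momentFunctional_monomial M (0 : Fin N →₀ ℕ) 1
  simpa [hM.zero] using this

/-- Independence in algebraic form: `p` does not involve the variable `X a`. -/
theorem momentFunctional_X_pow_mul (hM : IsStandardized M) {a : Fin N} (k : ℕ)
    {p : MvPolynomial (Fin N) ℝ}
    (hp : p ∈ supported ℝ {a}ᶜ) :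
    momentFunctional M N (X a ^ k * p) = M k * momentFunctional M N p := by
  have ha : a ∉ p.vars := fun h => (mem_supported.mp hp) (Finset.mem_coe.mpr h) rfl
  conv_lhs => rw [p.as_sum]
  conv_rhs => rw [p.as_sum]
  simp only [Finset.mul_sum, map_sum]
  refine Finset.sum_congr rfl fun s hs => ?_
  have hsa : s a = 0 := by
    by_contra h
    exact ha ((mem_vars_iff_mem_support a).mpr ⟨s, hs, Finsupp.mem_support_iff.mpr h⟩)
  rw [X_pow_eq_monomial, monomial_mul, momentFunctional_monomial, momentFunctional_monomial,
    ← Finset.mul_prod_erase _ _ (Finset.mem_univ a),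
    ← Finset.mul_prod_erase _ (fun i => M (s i)) (Finset.mem_univ a)]
  have : ∏ i ∈ Finset.univ.erase a, M ((Finsupp.single a k + s) i) =
      ∏ i ∈ Finset.univ.erase a, M (s i) := Finset.prod_congr rfl fun i hi => by
    simp [Finsupp.single_eq_of_ne (Finset.ne_of_mem_erase hi)]
  rw [this]
  simp [hsa, hM.zero]
  ring

theorem momentFunctional_X_mul (hM : IsStandardized M) {a : Fin N} {p : MvPolynomial (Fin N) ℝ}
    (hp : p ∈ supported ℝ {a}ᶜ) : momentFunctional M N (X a * p) = 0 := by
  simpa [hM.one] using momentFunctional_X_pow_mul hM 1 hp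

theorem momentFunctional_X_pow (hM : IsStandardized M) {a : Fin N} (k : ℕ) :
    momentFunctional M N (X a ^ k) = M k := by
  simpa [momentFunctional_one hM] using momentFunctional_X_pow_mul (a := a) hM k (one_mem _)

theorem X_mem_supported_compl {a b : Fin N} (h : b ≠ a) :
    (X b : MvPolynomial (Fin N) ℝ) ∈ supported ℝ {a}ᶜ :=
  X_mem_supported.mpr h

theorem momentFunctional_X₂ (hM : IsStandardized M) (i j : Fin N) :
    momentFunctional M N (X i * X j) = if i = j then 1 else 0 := by
  split_ifs with h
  · rw [h, ← sq, momentFunctional_X_pow hM, hM.two]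
  · exact momentFunctional_X_mul hM (X_mem_supported_compl (Ne.symm h))

theorem momentFunctional_X₃ (hM : IsStandardized M) (i j k : Fin N) :
    momentFunctional M N (X i * (X j * X k)) =
      M 3 * ((if i = j then 1 else 0) * if i = k then 1 else 0) := by
  by_cases hij : i = j
  · subst hij
    by_cases hik : i = k
    · subst hik
      rw [show (X i * (X i * X i) : MvPolynomial (Fin N) ℝ) = X i ^ 3 by ring,
        momentFunctional_X_pow hM]
      simp
    · rw [show (X i * (X i * X k) : MvPolynomial (Fin N) ℝ) = X k * (X i * X i) by ring,
        momentFunctional_X_mul hM (mul_mem (X_mem_supported_compl hik)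
          (X_mem_supported_compl hik))]
      simp [hik]
  · by_cases hik : i = k
    · subst hik
      rw [show (X i * (X j * X i) : MvPolynomial (Fin N) ℝ) = X j * (X i * X i) by ring,
        momentFunctional_X_mul hM (mul_mem (X_mem_supported_compl hij)
          (X_mem_supported_compl hij))]
      simp [hij]
    · rw [momentFunctional_X_mul hM (mul_mem (X_mem_supported_compl (Ne.symm hij))
          (X_mem_supported_compl (Ne.symm hik)))]
      simp [hij]

/-- The three pairings of Wick's formula, corrected on the diagonal by the fourth cumulant `M 4 -
3`. -/
theorem momentFunctional_X₄ (hM : IsStandardized M) (i j k l : Fin N) :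
    momentFunctional M N (X i * (X j * (X k * X l))) =
      (if i = j then 1 else 0) * (if k = l then 1 else 0) +
      (if i = k then 1 else 0) * (if j = l then 1 else 0) +
      (if i = l then 1 else 0) * (if j = k then 1 else 0) +
      (M 4 - 3) * ((if i = j then 1 else 0) * (if i = k then 1 else 0) *
        (if i = l then 1 else 0)) := by
  have single : ∀ {a b : Fin N}, a ≠ b → momentFunctional M N (X b * (X a * (X a * X a))) = 0 :=
    fun h => momentFunctional_X_mul hM (mul_mem (X_mem_supported_compl h)
      (mul_mem (X_mem_supported_compl h) (X_mem_supported_compl h)))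
  have pair : ∀ {a b c : Fin N}, a ≠ b → a ≠ c →
      momentFunctional M N (X a ^ 2 * (X b * X c)) = if b = c then 1 else 0 := fun h h' => by
    rw [momentFunctional_X_pow_mul hM _ (mul_mem (X_mem_supported_compl h.symm)
      (X_mem_supported_compl h'.symm)), hM.two, one_mul, momentFunctional_X₂ hM]
  by_cases hij : i = j
  · subst hij
    by_cases hik : i = k
    · subst hik
      by_cases hil : i = l
      · subst hil
        rw [show (X i * (X i * (X i * X i)) : MvPolynomial (Fin N) ℝ) = X i ^ 4 by ring,
          momentFunctional_X_pow hM]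
        simp
        ring
      · rw [show (X i * (X i * (X i * X l)) : MvPolynomial (Fin N) ℝ) =
          X l * (X i * (X i * X i)) by ring, single hil]
        simp [hil]
    · by_cases hil : i = l
      · subst hil
        rw [show (X i * (X i * (X k * X i)) : MvPolynomial (Fin N) ℝ) =
          X k * (X i * (X i * X i)) by ring, single hik]
        simp [hik, Ne.symm hik]
      · rw [show (X i * (X i * (X k * X l)) : MvPolynomial (Fin N) ℝ) =
          X i ^ 2 * (X k * X l) by ring, pair hik hil]
        simp [hik, hil]
  · by_cases hik : i = k
    · subst hik
      by_cases hil : i = l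
      · subst hil
        rw [show (X i * (X j * (X i * X i)) : MvPolynomial (Fin N) ℝ) =
          X j * (X i * (X i * X i)) by ring, single hij]
        simp [hij, Ne.symm hij]
      · rw [show (X i * (X j * (X i * X l)) : MvPolynomial (Fin N) ℝ) =
          X i ^ 2 * (X j * X l) by ring, pair hij hil]
        simp [hij, hil]
    · by_cases hil : i = l
      · subst hil
        rw [show (X i * (X j * (X k * X i)) : MvPolynomial (Fin N) ℝ) =
          X i ^ 2 * (X j * X k) by ring, pair hij hik]
        simp [hij, hik]
      · rw [momentFunctional_X_mul hM (mul_mem (X_mem_supported_compl (Ne.symm hij))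
          (mul_mem (X_mem_supported_compl (Ne.symm hik)) (X_mem_supported_compl (Ne.symm hil))))]
        simp [hij, hik, hil]

/-- The linear form with the given coefficients. -/
noncomputable def linForm (a : Fin N → ℝ) : MvPolynomial (Fin N) ℝ := ∑ i, a i • X i

theorem linForm_single (i : Fin N) : linForm (Pi.single i 1) = X i := by
  simp [linForm, Pi.single_apply]

theorem linForm_mem_supported {a : Fin N → ℝ} {i : Fin N} (h : a i = 0) :
    linForm a ∈ supported ℝ {i}ᶜ := by
  refine sum_mem fun j _ => ?_
  by_cases hj : j = i
  · rw [hj, h, zero_smul]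
    exact zero_mem _
  · exact Subalgebra.smul_mem _ (X_mem_supported_compl hj) _

theorem momentFunctional_linForm₁ (hM : IsStandardized M) (a : Fin N → ℝ) :
    momentFunctional M N (linForm a) = 0 := by
  rw [linForm, map_sum]
  refine Finset.sum_eq_zero fun i _ => ?_
  rw [map_smul, ← mul_one (X i), momentFunctional_X_mul hM (one_mem _), smul_zero]

theorem momentFunctional_linForm₂ (hM : IsStandardized M) (a b : Fin N → ℝ) :
    momentFunctional M N (linForm a * linForm b) = ∑ i, a i * b i := by
  simp only [linForm, Finset.sum_mul_sum, smul_mul_smul_comm, map_sum, map_smul, smul_eq_mul,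
    momentFunctional_X₂ hM]
  simp

theorem momentFunctional_linForm_mul (a : Fin N → ℝ) (p : MvPolynomial (Fin N) ℝ) :
    momentFunctional M N (linForm a * p) = ∑ i, a i * momentFunctional M N (X i * p) := by
  simp only [linForm, Finset.sum_mul, smul_mul_assoc, map_sum, map_smul, smul_eq_mul]

theorem momentFunctional_linForm₃ (hM : IsStandardized M) (a b c : Fin N → ℝ) :
    momentFunctional M N (linForm a * (linForm b * linForm c)) =
      M 3 * ∑ i, a i * b i * c i := by
  rw [momentFunctional_linForm_mul, Finset.mul_sum]
  refine Finset.sum_congr rfl fun i _ => ?_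
  simp only [mul_left_comm (X _) (linForm _), mul_comm (X _) (linForm _),
    momentFunctional_linForm_mul, momentFunctional_X₃ hM]
  simp only [Finset.mul_sum]
  rw [Finset.sum_comm]
  simp
  ring

theorem momentFunctional_linForm₄ (hM : IsStandardized M) (a b c d : Fin N → ℝ) :
    momentFunctional M N (linForm a * (linForm b * (linForm c * linForm d))) =
      (∑ i, a i * b i) * (∑ i, c i * d i) + (∑ i, a i * c i) * (∑ i, b i * d i) +
      (∑ i, a i * d i) * (∑ i, b i * c i) + (M 4 - 3) * ∑ i, a i * b i * c i * d i := by
  simp only [mul_left_comm (X _) (linForm _), mul_comm (X _) (linForm _),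
    momentFunctional_linForm_mul, momentFunctional_X₄ hM, mul_add, Finset.sum_add_distrib]
  congr 1
  · congr 1
    · congr 1
      · simp [Finset.sum_mul, mul_assoc]
      · rw [Finset.sum_mul_sum]
        simp only [Finset.mul_sum]
        simp
        exact Finset.sum_congr rfl fun i _ => Finset.sum_congr rfl fun j _ => by ring
    · rw [Finset.sum_mul_sum]
      simp only [Finset.mul_sum]
      simp
      exact Finset.sum_congr rfl fun i _ => Finset.sum_congr rfl fun j _ => by ring
  · simp [Finset.mul_sum]
    exact Finset.sum_congr rfl fun i _ => by ring

/-- For `0`-`1` vectors `u`, `w` with linear forms `U`, `Y` and an element `a` of the support of `u`,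
the expectation of `X_a U² Y³`. -/
theorem momentFunctional_X_mul_sq_mul_cube (hM : IsStandardized M) {u w : Fin N → ℝ}
    (hu : ∀ i, u i = 0 ∨ u i = 1) (hw : ∀ i, w i = 0 ∨ w i = 1) {a : Fin N} (ha : u a = 1) :
    momentFunctional M N (X a * (linForm u * (linForm u * (linForm w * (linForm w * linForm w))))) =
      6 * (w a * (∑ i, u i * w i) ^ 2) +
      (6 * ((∑ i, u i * w i) * ∑ i, w i) +
      (3 * (M 4 - 3) + 6 * M 4 + 9 * M 3 ^ 2 - 18) * (w a * ∑ i, u i * w i) +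
      (3 * M 4 - 9) * (w a * ∑ i, w i) +
      (15 - 5 * (M 4 - 3) - 10 * M 3 ^ 2 - 10 * M 4 + M 6) * w a +
      2 * (M 4 - 3) * (∑ i, u i * w i) +
      3 * (w a * ((∑ i, u i) * ∑ i, w i)) + (M 4 - 3) * (w a * ∑ i, u i) +
      M 3 ^ 2 * ∑ i, w i) := by
  -- Clearing the coordinate `a` makes the remaining linear forms independent of `X a`. The product
  -- is then expanded in powers of `X a`, whose coefficients involve at most four linear forms,
  -- apart from the first-power term, which vanishes by centering.
  let u' := Function.update u a 0
  let w' := Function.update w a 0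
  have hu0 : u' a = 0 := Function.update_self ..
  have hw0 : w' a = 0 := Function.update_self ..
  have hu1 : ∀ i, i ≠ a → u' i = u i := fun i hi => Function.update_of_ne hi ..
  have hw1 : ∀ i, i ≠ a → w' i = w i := fun i hi => Function.update_of_ne hi ..
  have hu' : ∀ i, u' i = 0 ∨ u' i = 1 := fun i => by
    by_cases h : i = a
    · exact .inl (h ▸ hu0)
    · rw [hu1 i h]
      exact hu i
  have hw' : ∀ i, w' i = 0 ∨ w' i = 1 := fun i => by
    by_cases h : i = a
    · exact .inl (h ▸ hw0)
    · rw [hw1 i h]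
      exact hw i
  have split : ∀ (f f' : Fin N → ℝ), f' a = 0 → (∀ i, i ≠ a → f' i = f i) →
      ∑ i, f i = ∑ i, f' i + f a := by
    intro f f' h h'
    rw [← Finset.sum_erase_add _ _ (Finset.mem_univ a), ← Finset.sum_erase _ h]
    congr 1
    exact Finset.sum_congr rfl fun i hi => (h' i (Finset.ne_of_mem_erase hi)).symm
  have su : ∑ i, u i = ∑ i, u' i + 1 := by rw [split u u' hu0 hu1, ha]
  have sw : ∑ i, w i = ∑ i, w' i + w a := split w w' hw0 hw1
  have suw : ∑ i, u i * w i = ∑ i, u' i * w' i + w a := by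
    rw [split _ (fun i => u' i * w' i) (by simp [hu0]) fun i hi => by rw [hu1 i hi, hw1 i hi], ha,
      one_mul]
  have lin : ∀ (f f' : Fin N → ℝ), f' a = 0 → (∀ i, i ≠ a → f' i = f i) →
      linForm f = linForm f' + C (f a) * X a := by
    intro f f' h h'
    have e : ∀ i, f i • (X i : MvPolynomial (Fin N) ℝ) =
        f' i • X i + if i = a then C (f a) * X a else 0 := fun i => by
      by_cases hi : i = a
      · simp [hi, h, smul_eq_C_mul]
      · simp [hi, h' i hi]
    simp only [linForm, e, Finset.sum_add_distrib]
    simp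
  have mu : linForm u' ∈ supported ℝ {a}ᶜ := linForm_mem_supported hu0
  have mw : linForm w' ∈ supported ℝ {a}ᶜ := linForm_mem_supported hw0
  rw [su, sw, suw, lin u u' hu0 hu1, lin w w' hw0 hw1, ha]
  have hs := hw a
  generalize w a = s at hs ⊢
  have expand : (X a * ((linForm u' + C 1 * X a) * ((linForm u' + C 1 * X a) *
      ((linForm w' + C s * X a) * ((linForm w' + C s * X a) * (linForm w' + C s * X a))))) :
      MvPolynomial (Fin N) ℝ) =
      X a ^ 1 * (linForm u' * (linForm u' * (linForm w' * (linForm w' * linForm w')))) +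
      C 2 * (X a ^ 2 * (linForm u' * (linForm w' * (linForm w' * linForm w')))) +
      C (3 * s) * (X a ^ 2 * (linForm u' * (linForm u' * (linForm w' * linForm w')))) +
      C 1 * (X a ^ 3 * (linForm w' * (linForm w' * linForm w'))) +
      C (6 * s) * (X a ^ 3 * (linForm u' * (linForm w' * linForm w'))) +
      C (3 * s ^ 2) * (X a ^ 3 * (linForm u' * (linForm u' * linForm w'))) +
      C (3 * s) * (X a ^ 4 * (linForm w' * linForm w')) +
      C (6 * s ^ 2) * (X a ^ 4 * (linForm u' * linForm w')) +
      C (s ^ 3) * (X a ^ 4 * (linForm u' * linForm u')) +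
      C (3 * s ^ 2) * (X a ^ 5 * linForm w') + C (2 * s ^ 3) * (X a ^ 5 * linForm u') +
      C (s ^ 3) * (X a ^ 6 * 1) := by
    simp only [map_mul, map_pow, map_one, map_ofNat]
    ring
  have idem : ∀ {f : Fin N → ℝ}, (∀ i, f i = 0 ∨ f i = 1) → ∀ i, f i * f i = f i := fun h i => by
    rcases h i with h | h <;> simp [h]
  have iu := idem hu'
  have iw := idem hw'
  rw [expand]
  simp only [map_add, ← smul_eq_C_mul, map_smul, smul_eq_mul,
    momentFunctional_X_pow_mul hM _ (mul_mem mu (mul_mem mu (mul_mem mw (mul_mem mw mw)))),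
    momentFunctional_X_pow_mul hM _ (mul_mem mu (mul_mem mw (mul_mem mw mw))),
    momentFunctional_X_pow_mul hM _ (mul_mem mu (mul_mem mu (mul_mem mw mw))),
    momentFunctional_X_pow_mul hM _ (mul_mem mw (mul_mem mw mw)),
    momentFunctional_X_pow_mul hM _ (mul_mem mu (mul_mem mw mw)),
    momentFunctional_X_pow_mul hM _ (mul_mem mu (mul_mem mu mw)),
    momentFunctional_X_pow_mul hM _ (mul_mem mw mw),
    momentFunctional_X_pow_mul hM _ (mul_mem mu mw),
    momentFunctional_X_pow_mul hM _ (mul_mem mu mu),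
    momentFunctional_X_pow_mul hM _ mw, momentFunctional_X_pow_mul hM _ mu,
    momentFunctional_X_pow_mul hM _ (one_mem _), momentFunctional_one hM,
    momentFunctional_linForm₁ hM, momentFunctional_linForm₂ hM, momentFunctional_linForm₃ hM,
    momentFunctional_linForm₄ hM, hM.one, hM.two, mul_assoc, iu, iw]
  -- The two sides contain different powers of `s` and agree because `s` is `0` or `1`.
  rcases hs with rfl | rfl <;> ring

end moments

/-! ### Extra edges by moments -/

/-- The edge `e` joins `a` and `b`. -/
def joins (a b : ℕ) (e : ℕ × ℕ) : Bool :=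
  (e.1.beq a && e.2.beq b) || (e.1.beq b && e.2.beq a)

/-- Some edge of the list joins `a` and `b`. -/
def hasEdge (E : List (ℕ × ℕ)) (a b : ℕ) : Bool := E.any (joins a b)

theorem hasEdge_iff {E : List (ℕ × ℕ)} {a b : ℕ} :
    hasEdge E a b = true ↔ (a, b) ∈ E ∨ (b, a) ∈ E := by
  simp only [hasEdge, joins, List.any_eq_true, Bool.or_eq_true, Bool.and_eq_true, Nat.beq_eq]
  constructor
  · rintro ⟨e, he, ⟨rfl, rfl⟩ | ⟨rfl, rfl⟩⟩
    exacts [.inl he, .inr he]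
  · rintro (h | h)
    exacts [⟨_, h, .inl ⟨rfl, rfl⟩⟩, ⟨_, h, .inr ⟨rfl, rfl⟩⟩]

theorem apply_eq_one_of_hasEdge {V : Type*} {S : Matrix V V ℝ} (hS : S.IsAdjMatrix)
    {E : List (ℕ × ℕ)} {x : ℕ → V} (hx : ∀ e ∈ E, S (x e.1) (x e.2) = 1) {a b : ℕ}
    (h : hasEdge E a b = true) : S (x a) (x b) = 1 := by
  rcases hasEdge_iff.mp h with h | h
  · exact hx _ h
  · rw [hS.symm.apply]
    exact hx _ h

/-- Degrees are shifts of the constant `1`; they are scalars and pass through the functional. -/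
theorem treeAttainable_slots_degrees {L : SignalFunctional} {par : List ℕ}
    (hpar : parentsValid 1 par) (ds : List ℕ) (hds : ∀ d ∈ ds, d < par.length + 1)
    (sl : List (ℕ × NodeProg)) (hsl : ∀ s ∈ sl, s.1 < par.length + 1) :
    TreeAttainable L par fun N S x => (ds.map fun d => ∑ w, S (x d) w).prod *
      L N (sl.map fun s => s.2.eval S MvPolynomial.X (x s.1)).prod := by
  refine (treeAttainable_slots hpar (ds.map (fun d => (d, NodeProg.one.shift)) ++ sl) ?_).congr
    hpar fun N S _ x _ => ?_
  · intro s hs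
    rcases List.mem_append.mp hs with hs | hs
    · obtain ⟨d, hd, rfl⟩ := List.mem_map.mp hs
      exact hds d hd
    · exact hsl s hs
  · rw [List.map_append, List.prod_append]
    generalize (sl.map fun s => s.2.eval S (MvPolynomial.X (R := ℝ)) (x s.1)).prod = P
    clear hds hsl
    induction ds with
    | nil => simp
    | cons d ds ih =>
      simp only [List.map_cons, List.prod_cons, mul_assoc]
      rw [← ih]
      simp [NodeProg.eval, ← Finset.sum_smul]

theorem eval_shift_input {N : ℕ} (S : Matrix (Fin N) (Fin N) ℝ) (v : Fin N) :
    NodeProg.input.shift.eval S MvPolynomial.X v = linForm (S v) := rfl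

theorem eval_input {N : ℕ} (S : Matrix (Fin N) (Fin N) ℝ) (v : Fin N) :
    NodeProg.input.eval S MvPolynomial.X v = linForm (Pi.single v 1) := (linForm_single v).symm

section moments

variable {M : ℕ → ℝ} {par : List ℕ}

theorem treeAttainable_degrees (hM : IsStandardized M) (hpar : parentsValid 1 par)
    (ds : List ℕ) (hds : ∀ d ∈ ds, d < par.length + 1) :
    TreeAttainable (momentFunctional M) par fun _ S x => (ds.map fun d => ∑ w, S (x d) w).prod := by
  refine (treeAttainable_slots_degrees hpar ds hds [(0, .input), (0, .input)] (by simp)).congr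
    hpar fun N S _ x _ => ?_
  simp [eval_input, momentFunctional_linForm₂ hM, Pi.single_apply]

theorem treeAttainable_degrees_edge (hM : IsStandardized M) (hpar : parentsValid 1 par)
    (ds : List ℕ) (hds : ∀ d ∈ ds, d < par.length + 1) {u m : ℕ}
    (hu : u < par.length + 1) (hm : m < par.length + 1) :
    TreeAttainable (momentFunctional M) par fun _ S x =>
      (ds.map fun d => ∑ w, S (x d) w).prod * S (x u) (x m) := by
  refine (treeAttainable_slots_degrees hpar ds hds [(m, .input), (u, .shift .input)]
    (by simp; omega)).congr hpar fun N S _ x _ => ?_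
  simp [eval_input, eval_shift_input, momentFunctional_linForm₂ hM, Pi.single_apply]

theorem treeAttainable_degrees_path (hM : IsStandardized M) (hpar : parentsValid 1 par)
    (ds : List ℕ) (hds : ∀ d ∈ ds, d < par.length + 1) {u w : ℕ}
    (hu : u < par.length + 1) (hw : w < par.length + 1) :
    TreeAttainable (momentFunctional M) par fun _ S x =>
      (ds.map fun d => ∑ w, S (x d) w).prod * ∑ i, S (x u) i * S (x w) i := by
  refine (treeAttainable_slots_degrees hpar ds hds [(u, .shift .input), (w, .shift .input)]
    (by simp; omega)).congr hpar fun N S _ x _ => ?_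
  simp [eval_shift_input, momentFunctional_linForm₂ hM]

/-- In the mean of `q_{m₁} q_{m₂} (S q)_{u₁} (S q)_{u₂}` the pairing of `m₁` with `m₂` and the
cumulant term vanish, because adjacent tree vertices have different images. The crossed pairing
loses its factor on the tree edge `u₁ m₂`, so a single extra edge remains to be subtracted. -/
theorem treeAttainable_edge_pair (hM : IsStandardized M) (hpar : parentsValid 1 par)
    {m₁ u₁ m₂ u₂ : ℕ} (hm₁ : m₁ < par.length + 1)
    (hu₁ : u₁ < par.length + 1) (hm₂ : m₂ < par.length + 1) (hu₂ : u₂ < par.length + 1)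
    (h : hasEdge (treeEdges 1 par) m₁ m₂) (h' : hasEdge (treeEdges 1 par) u₁ m₂) :
    TreeAttainable (momentFunctional M) par fun _ S x =>
      S (x m₁) (x u₁) * S (x m₂) (x u₂) := by
  have hslots := treeAttainable_slots (L := momentFunctional M) hpar
    [(m₁, .input), (m₂, .input), (u₁, .shift .input), (u₂, .shift .input)]
    (by simp; omega)
  have hedge := treeAttainable_degrees_edge hM hpar [] (by simp) hu₂ hm₁
  refine (hslots.add (hedge.smul (-1))).congr hpar fun N S hS x hx => ?_
  have e := apply_eq_one_of_hasEdge hS hx h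
  have e' := apply_eq_one_of_hasEdge hS hx h'
  have hne : x m₁ ≠ x m₂ := by
    intro hne
    rw [hne, hS.apply_diag] at e
    exact zero_ne_one e
  simp only [eval_input, eval_shift_input, List.map_cons, List.map_nil, List.prod_cons,
    List.prod_nil, mul_one, momentFunctional_linForm₄ hM]
  simp [Pi.single_apply, hne.symm, e', hS.symm.apply (x u₁) (x m₁), hS.symm.apply (x u₂) (x m₂)]

/-- In the mean of `q_a (S q)_u (S q)_w²` two pairings give the wanted product. The third gives the
degree of `w`, and the cumulant term a single edge, since `u` and `a` are joined in the tree. -/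
theorem treeAttainable_edge_path (hM : IsStandardized M) (hpar : parentsValid 1 par)
    {a u w : ℕ} (ha : a < par.length + 1)
    (hu : u < par.length + 1) (hw : w < par.length + 1) (h : hasEdge (treeEdges 1 par) u a) :
    TreeAttainable (momentFunctional M) par fun _ S x =>
      S (x w) (x a) * ∑ i, S (x u) i * S (x w) i := by
  have hslots := treeAttainable_slots (L := momentFunctional M) hpar
    [(a, .input), (u, .shift .input), (w, .shift .input), (w, .shift .input)]
    (by simp; omega)
  have h₁ := treeAttainable_degrees hM hpar [w] (by simp; omega)
  have h₂ := treeAttainable_degrees_edge hM hpar [] (by simp) hw ha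
  refine ((hslots.smul (1 / 2)).add ((h₁.smul (-1 / 2)).add
    (h₂.smul (-(M 4 - 3) / 2)))).congr hpar fun N S hS x hx => ?_
  have e := apply_eq_one_of_hasEdge hS hx h
  have idem : ∀ i, S (x w) i * S (x w) i = S (x w) i := fun i => by
    rcases hS.zero_or_one (x w) i with h | h <;> simp [h]
  simp only [eval_input, eval_shift_input, List.map_cons, List.map_nil, List.prod_cons,
    List.prod_nil, mul_one, momentFunctional_linForm₄ hM]
  simp [Pi.single_apply, e, idem]
  ring

theorem treeAttainable_edge_path_sq (hM : IsStandardized M) (hpar : parentsValid 1 par)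
    {a u w : ℕ} (ha : a < par.length + 1)
    (hu : u < par.length + 1) (hw : w < par.length + 1) (h : hasEdge (treeEdges 1 par) u a) :
    TreeAttainable (momentFunctional M) par fun _ S x =>
      S (x w) (x a) * (∑ i, S (x u) i * S (x w) i) ^ 2 := by
  have hslots := treeAttainable_slots (L := momentFunctional M) hpar
    [(a, .input), (u, .shift .input), (u, .shift .input), (w, .shift .input), (w, .shift .input),
      (w, .shift .input)] (by simp; omega)
  have h₁ := treeAttainable_degrees_path hM hpar [w] (by simp; omega) hu hw
  have h₂ := treeAttainable_edge_path hM hpar ha hu hw h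
  have h₃ := treeAttainable_degrees_edge hM hpar [w] (by simp; omega) hw ha
  have h₄ := treeAttainable_degrees_edge hM hpar [] (by simp) hw ha
  have h₅ := treeAttainable_degrees_path hM hpar [] (by simp) hu hw
  have h₆ := treeAttainable_degrees_edge hM hpar [u, w] (by simp; omega) hw ha
  have h₇ := treeAttainable_degrees_edge hM hpar [u] (by simp; omega) hw ha
  have h₈ := treeAttainable_degrees hM hpar [w] (by simp; omega)
  have hrest := (h₁.smul 6).add <|
    (h₂.smul (3 * (M 4 - 3) + 6 * M 4 + 9 * M 3 ^ 2 - 18)).add <| (h₃.smul (3 * M 4 - 9)).add <|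
    (h₄.smul (15 - 5 * (M 4 - 3) - 10 * M 3 ^ 2 - 10 * M 4 + M 6)).add <|
    (h₅.smul (2 * (M 4 - 3))).add <| (h₆.smul 3).add <| (h₇.smul (M 4 - 3)).add
    (h₈.smul (M 3 ^ 2))
  -- The factor `6` counts the pairings of `a` with one of three copies of `w` and of the other two
  -- copies with the two copies of `u`. Every other term of the sixth moment is in `hrest`.
  refine ((hslots.smul (1 / 6)).add (hrest.smul (-1 / 6))).congr hpar fun N S hS x hx => ?_
  have e := apply_eq_one_of_hasEdge hS hx h
  have key := momentFunctional_X_mul_sq_mul_cube hM (hS.zero_or_one (x u)) (hS.zero_or_one (x w)) e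
  simp only [eval_input, linForm_single, eval_shift_input, List.map_cons, List.map_nil,
    List.prod_cons, List.prod_nil, mul_one, key]
  ring

theorem treeAttainable_book_spine (hM : IsStandardized M) :
    TreeAttainable (momentFunctional M) [0, 0, 0, 0] fun _ S x => edgeWeight S [(1, 2), (3, 2), (4, 2)] x := by
  -- The common edge of the triangles is placed on `0` and `2`. One third vertex is in the tree; the
  -- square of the number of common neighbours accounts for the other two.
  refine Attainable.congr (treeAttainable_edge_path_sq hM (par := [0, 0]) (a := 1) (u := 0) (w := 2)
    rfl (by simp) (by simp) (by simp) rfl) fun N S hS v => ?_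
  simp only [treeSum, edgeWeight, smul_eq_mul]
  refine Finset.sum_congr rfl fun y _ => ?_
  congr 1
  refine Finset.sum_congr rfl fun z _ => ?_
  congr 1
  rw [sq, Finset.sum_mul_sum, Finset.mul_sum]
  refine Finset.sum_congr rfl fun b _ => ?_
  rw [Finset.mul_sum, Finset.mul_sum]
  refine Finset.sum_congr rfl fun c _ => ?_
  simp [hS.symm.apply z]
  ring

theorem treeAttainable_book_page (hM : IsStandardized M) :
    TreeAttainable (momentFunctional M) [0, 1, 1, 1] fun _ S x => edgeWeight S [(0, 2), (3, 2), (4, 2)] x := by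
  -- Here the root is a third vertex, and the common edge is placed on `1` and `2`.
  refine Attainable.congr (treeAttainable_edge_path_sq hM (par := [0, 1]) (a := 0) (u := 1) (w := 2)
    rfl (by simp) (by simp) (by simp) rfl) fun N S hS v => ?_
  simp only [treeSum, edgeWeight, smul_eq_mul]
  refine Finset.sum_congr rfl fun y _ => ?_
  congr 1
  refine Finset.sum_congr rfl fun z _ => ?_
  congr 1
  rw [sq, Finset.sum_mul_sum, Finset.mul_sum]
  refine Finset.sum_congr rfl fun b _ => ?_
  rw [Finset.mul_sum, Finset.mul_sum]
  refine Finset.sum_congr rfl fun c _ => ?_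
  simp [hS.symm.apply z]
  ring

end moments

/-- There is at most one additional edge, or there are two of which one closes a triangle at an
end vertex of the other, or the graph is the union of three triangles with a common edge. -/
def pairRule (par : List ℕ) (ex : List (ℕ × ℕ)) : Bool :=
  match ex with
  | [] => true
  | [_] => true
  | [e, f] => hasEdge (treeEdges 1 par) e.1 f.1 && hasEdge (treeEdges 1 par) e.2 f.1
  | _ => (par == [0, 0, 0, 0] && ex == [(1, 2), (3, 2), (4, 2)]) ||
      (par == [0, 1, 1, 1] && ex == [(0, 2), (3, 2), (4, 2)])

theorem soundRule_pairRule {M : ℕ → ℝ} (hM : IsStandardized M) :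
    SoundRule (momentFunctional M) pairRule := by
  intro par ex hpar hex hrule
  match ex, hrule with
  | [], _ => simpa [edgeWeight] using treeAttainable_degrees hM hpar [] (by simp)
  | [e], _ =>
    have he := hex e (by simp)
    simpa [edgeWeight] using treeAttainable_degrees_edge hM hpar [] (by simp) he.1 he.2
  | [e, f], hrule =>
    have he := hex e (by simp)
    have hf := hex f (by simp)
    simp only [pairRule, Bool.and_eq_true] at hrule
    simpa [edgeWeight] using
      treeAttainable_edge_pair hM hpar he.1 he.2 hf.1 hf.2 hrule.1 hrule.2
  | e :: f :: g :: es, hrule =>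
    simp only [pairRule, Bool.or_eq_true, Bool.and_eq_true, beq_iff_eq] at hrule
    rcases hrule with ⟨rfl, h⟩ | ⟨rfl, h⟩
    · rw [h]
      exact treeAttainable_book_spine hM
    · rw [h]
      exact treeAttainable_book_page hM

/-! ### Quotients of a cycle and their certificates -/

/-- The pairs of cyclically consecutive members of a list. -/
def closedSteps (w : List ℕ) : List (ℕ × ℕ) := w.zip (w.tail ++ [w.headD 0])

/-- Words of length `n` in which the `i`-th letter is either `i` or a repetition of an earlier
letter. They encode the partitions of the set of positions. -/
def labelWords : ℕ → List (List ℕ)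
  | 0 => [[]]
  | n + 1 => (labelWords n).flatMap fun w => (w.dedup ++ [n]).map fun a => w ++ [a]

/-- A presentation of a graph by an enumeration of its vertices, a spanning tree, and the edges
outside that tree, the latter two in terms of the enumeration. -/
structure TreePresentation where
  order : List ℕ
  parents : List ℕ
  extra : List (ℕ × ℕ)

/-- Checks that the presentation describes the graph traced out by the closed walk `w`, and that it
satisfies the given rule. -/
def TreePresentation.check (rule : List ℕ → List (ℕ × ℕ) → Bool) (w : List ℕ)
    (K : TreePresentation) : Bool :=
  let E := treeEdges 1 K.parents ++ K.extra
  let l := w.map fun a => K.order.idxOf a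
  let s := closedSteps l
  parentsValid 1 K.parents && K.order.length.beq (K.parents.length + 1) &&
  (l.headD 0).beq 0 && w.all (fun a => K.order.contains a) &&
  (List.range (K.parents.length + 1)).all (fun t => l.contains t) &&
  s.all (fun e => hasEdge E e.1 e.2) && E.all (fun e => hasEdge s e.1 e.2) &&
  K.extra.all (fun e => e.1.blt (K.parents.length + 1) && e.2.blt (K.parents.length + 1)) &&
  rule K.parents K.extra

/-- Grows a tree from the vertices `ord` with edges in `R`, trying the vertices in the given order
of priority. -/
def growTree (R : List (ℕ × ℕ)) (priority : List ℕ) : ℕ → List ℕ → List ℕ → List ℕ × List ℕ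
  | 0, ord, par => (ord, par)
  | n + 1, ord, par =>
    match priority.find? (fun b => !ord.contains b && ord.any fun a => hasEdge R a b) with
    | none => (ord, par)
    | some b => growTree R priority n (ord ++ [b]) (par ++ [ord.findIdx fun a => hasEdge R a b])

/-- The presentation of a graph that leaves the edges `ex` outside the spanning tree. -/
def presentation (E : List (ℕ × ℕ)) (verts : List ℕ) (ex : List (ℕ × ℕ)) : TreePresentation :=
  let r := growTree (E.filter fun e => !hasEdge ex e.1 e.2)
    -- Ends of extra edges have priority, so that the numbering can match the two literal forms in
    -- `pairRule`.
    (ex.flatMap (fun e => [e.1, e.2]) ++ verts) verts.length [0] []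
  ⟨r.1, r.2, ex.map fun e => (r.1.idxOf e.1, r.1.idxOf e.2)⟩

/-- Removes repeated edges. -/
def mergeEdges : List (ℕ × ℕ) → List (ℕ × ℕ)
  | [] => []
  | e :: es => if hasEdge es e.1 e.2 then mergeEdges es else e :: mergeEdges es

/-- Lists of edges that may be left outside a spanning tree: edges with a common end vertex, and
pairs of edges one of which forms a triangle with an end vertex of the other. -/
def extraCandidates (E : List (ℕ × ℕ)) (verts : List ℕ) : List (List (ℕ × ℕ)) :=
  let D := E ++ E.map Prod.swap
  (verts.flatMap fun m =>
    -- This length is the cyclomatic number, the number of edges outside any spanning tree.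
    (D.filter fun e => e.2.beq m).sublistsLen (E.length + 1 - verts.length)) ++
  (D.flatMap fun e => (D.filter fun f =>
    hasEdge E e.1 f.1 && hasEdge E e.2 f.1).map fun f => [e, f])

/-- The closed walk `w` contains a loop, or a search finds a presentation of its graph that satisfies
the rule. -/
def certified (rule : List ℕ → List (ℕ × ℕ) → Bool) (w : List ℕ) : Bool :=
  let E := mergeEdges (closedSteps w)
  let verts := w.dedup
  (closedSteps w).any (fun e => e.1.beq e.2) ||
  (extraCandidates E verts).any fun ex => (presentation E verts ex).check rule w

theorem mem_closedSteps {k : ℕ} [NeZero k] {w : List ℕ} (hw : w.length = k) {e : ℕ × ℕ} :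
    e ∈ closedSteps w ↔ ∃ i : Fin k, e = (w.getD i 0, w.getD (i + 1 : Fin k) 0) := by
  have hk : 0 < k := Nat.pos_of_ne_zero (NeZero.ne k)
  have hlen : (closedSteps w).length = k := by
    simp [closedSteps, hw]
    omega
  have hget : ∀ (i : Fin k) (h : (i : ℕ) < (closedSteps w).length),
      (closedSteps w)[(i : ℕ)] = (w.getD i 0, w.getD (i + 1 : Fin k) 0) := by
    intro i h
    have hi : (i : ℕ) < w.length := by omega
    simp only [closedSteps, List.getElem_zip, Prod.mk.injEq]
    refine ⟨by simp [hi], ?_⟩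
    obtain ⟨n, rfl⟩ : ∃ n, k = n + 1 := ⟨k - 1, by omega⟩
    obtain ⟨a, w, rfl⟩ := List.exists_cons_of_length_pos (hw ▸ hk)
    rw [Fin.val_add_one]
    by_cases hl : i = Fin.last n
    · subst hl
      simp at hw
      simp [hw]
    · have : (i : ℕ) < n := Fin.val_lt_last hl
      simp at hw
      simp [hl, hw, this]
  constructor
  · intro he
    obtain ⟨i, hi, rfl⟩ := List.getElem_of_mem he
    exact ⟨⟨i, hlen ▸ hi⟩, hget ⟨i, hlen ▸ hi⟩ hi⟩
  · rintro ⟨i, rfl⟩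
    rw [← hget i (hlen ▸ i.2)]
    exact List.getElem_mem _

theorem exists_labelWord (r : Setoid ℕ) (n : ℕ) :
    ∃ w ∈ labelWords n, w.length = n ∧ (∀ a ∈ w, a < n) ∧
      ∀ i < n, ∀ j < n, w.getD i 0 = w.getD j 0 ↔ r i j := by
  induction n with
  | zero => exact ⟨[], by simp [labelWords], rfl, by simp, by simp⟩
  | succ n ih =>
    obtain ⟨w, hw, hlen, hlt, hr⟩ := ih
    obtain ⟨a, ha, han, har⟩ : ∃ a, (a ∈ w ∨ a = n) ∧ a < n + 1 ∧
        ∀ i < n, w.getD i 0 = a ↔ r i n := by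
      by_cases h : ∃ j < n, r j n
      · obtain ⟨j, hj, hjn⟩ := h
        have hmem : w.getD j 0 ∈ w := by
          rw [List.getD_eq_getElem _ _ (by omega)]
          exact List.getElem_mem _
        refine ⟨w.getD j 0, .inl hmem, (hlt _ hmem).trans (Nat.lt_succ_self n), fun i hi => ?_⟩
        rw [hr i hi j hj]
        exact ⟨fun h => r.trans h hjn, fun h => r.trans h (r.symm hjn)⟩
      · push Not at h
        refine ⟨n, .inr rfl, Nat.lt_succ_self n, fun i hi => iff_of_false (fun e => ?_) (h i hi)⟩
        have hmem : w.getD i 0 ∈ w := by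
          rw [List.getD_eq_getElem _ _ (by omega)]
          exact List.getElem_mem _
        exact (hlt _ hmem).ne e
    refine ⟨w ++ [a], ?_, by simp [hlen], ?_, ?_⟩
    · simp only [labelWords, List.mem_flatMap, List.mem_map]
      exact ⟨w, hw, a, by simpa using ha, rfl⟩
    · intro b hb
      rcases List.mem_append.mp hb with hb | hb
      · exact (hlt b hb).trans (Nat.lt_succ_self n)
      · rw [List.mem_singleton.mp hb]
        exact han
    · have h₁ : ∀ i < n, (w ++ [a]).getD i 0 = w.getD i 0 := fun i hi =>
        List.getD_append _ _ _ _ (by omega)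
      have h₂ : (w ++ [a]).getD n 0 = a := by simp [← hlen]
      intro i hi j hj
      rcases Nat.lt_succ_iff_lt_or_eq.mp hi with hi | rfl <;>
        rcases Nat.lt_succ_iff_lt_or_eq.mp hj with hj | rfl
      · rw [h₁ i hi, h₁ j hj, hr i hi j hj]
      · rw [h₁ i hi, h₂, har i hi]
      · rw [h₁ j hj, h₂, eq_comm, har j hj]
        exact ⟨r.symm, r.symm⟩
      · exact iff_of_true rfl (r.refl _)

/-- The map on `ℕ` that is given by `z` on `i, i + 1, …` and by `x` elsewhere. -/
def extendAt {V : Type*} {n : ℕ} (x : ℕ → V) (i : ℕ) (z : Fin n → V) (j : ℕ) : V :=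
  if h : i ≤ j ∧ j - i < n then z ⟨j - i, h.2⟩ else x j

theorem extendAt_cons {V : Type*} {n : ℕ} (x : ℕ → V) (i : ℕ) (y : V) (z : Fin n → V) :
    extendAt x i (Fin.cons y z : Fin (n + 1) → V) = extendAt (Function.update x i y) (i + 1) z := by
  funext j
  unfold extendAt
  by_cases hij : j = i
  · subst hij
    simp
  · by_cases h : i + 1 ≤ j ∧ j - (i + 1) < n
    · have h' : i ≤ j ∧ j - i < n + 1 := by omega
      rw [dif_pos h, dif_pos h']
      have : (⟨j - i, h'.2⟩ : Fin (n + 1)) = Fin.succ ⟨j - (i + 1), h.2⟩ := by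
        ext
        simp
        omega
      rw [this, Fin.cons_succ]
    · rw [dif_neg h, dif_neg (by omega), Function.update_of_ne hij]

theorem extendAt_of_lt {V : Type*} {n : ℕ} (x : ℕ → V) {i j : ℕ} (h : j < i) (z : Fin n → V) :
    extendAt x i z j = x j := dif_neg (by omega)

theorem edgeWeight_append {V : Type*} (S : Matrix V V ℝ) (E F : List (ℕ × ℕ)) (x : ℕ → V) :
    edgeWeight S (E ++ F) x = edgeWeight S E x * edgeWeight S F x := by
  simp [edgeWeight]

theorem edgeWeight_cons {V : Type*} (S : Matrix V V ℝ) (e : ℕ × ℕ) (E : List (ℕ × ℕ))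
    (x : ℕ → V) : edgeWeight S (e :: E) x = S (x e.1) (x e.2) * edgeWeight S E x := by
  simp [edgeWeight]

theorem treeSum_eq_sum {V : Type*} [Fintype V] (S : Matrix V V ℝ) {par : List ℕ} {i : ℕ}
    (hpar : parentsValid i par) (x : ℕ → V) (φ : (ℕ → V) → ℝ) :
    treeSum S par i x φ = ∑ z : Fin par.length → V,
      edgeWeight S (treeEdges i par) (extendAt x i z) * φ (extendAt x i z) := by
  induction par generalizing i x with
  | nil =>
    have : ∀ z : Fin 0 → V, extendAt x i z = x := fun z => by
      funext j
      simp [extendAt]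
    simp [treeSum, edgeWeight, treeEdges, this]
  | cons p ps ih =>
    simp only [parentsValid, Bool.and_eq_true, Nat.blt_eq] at hpar
    simp only [treeSum, ih hpar.2, List.length_cons, smul_eq_mul]
    rw [← (Fin.consEquiv fun _ : Fin (ps.length + 1) => V).sum_comp, Fintype.sum_prod_type]
    refine Finset.sum_congr rfl fun y _ => ?_
    rw [Finset.mul_sum]
    refine Finset.sum_congr rfl fun z _ => ?_
    change _ = edgeWeight S _ (extendAt x i (Fin.cons y z : Fin (ps.length + 1) → V)) *
      φ (extendAt x i (Fin.cons y z : Fin (ps.length + 1) → V))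
    rw [extendAt_cons, treeEdges, edgeWeight_cons, extendAt_of_lt _ (by omega),
      extendAt_of_lt _ (by omega), Function.update_of_ne (by omega), Function.update_self, mul_assoc]

theorem edgeWeight_eq_ite {V : Type*} {S : Matrix V V ℝ} (hS : S.IsAdjMatrix) (E : List (ℕ × ℕ))
    (x : ℕ → V) [Decidable (∀ e ∈ E, S (x e.1) (x e.2) = 1)] :
    edgeWeight S E x = if ∀ e ∈ E, S (x e.1) (x e.2) = 1 then 1 else 0 := by
  split_ifs with h
  · exact List.prod_eq_one fun a ha => by
      obtain ⟨e, he, rfl⟩ := List.mem_map.mp ha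
      exact h e he
  · push Not at h
    obtain ⟨e, he, h⟩ := h
    refine List.prod_eq_zero (List.mem_map.mpr ⟨e, he, ?_⟩)
    exact (hS.zero_or_one _ _).resolve_right h

/-- Only the final check matters for correctness; how the presentation was found plays no role. -/
theorem attainable_of_certified {L : SignalFunctional} {rule : List ℕ → List (ℕ × ℕ) → Bool}
    (hrule : SoundRule L rule) {k : ℕ} [NeZero k] {w : List ℕ} (hw : w.length = k)
    (h : certified rule w = true) :
    Attainable L fun N S v => ∑ x : Fin k → Fin N with
      x 0 = v ∧ ∀ i j : Fin k, w.getD i 0 = w.getD j 0 → x i = x j, ∏ i, S (x i) (x (i + 1)) := by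
  have hk : 0 < k := Nat.pos_of_ne_zero (NeZero.ne k)
  simp only [certified, Bool.or_eq_true, List.any_eq_true] at h
  rcases h with ⟨e, he, hloop⟩ | ⟨ex, -, hK⟩
  · obtain ⟨i, rfl⟩ := (mem_closedSteps hw).mp he
    rw [Nat.beq_eq] at hloop
    refine attainable_zero.congr fun N S hS v => ?_
    refine (Finset.sum_eq_zero fun x hx => ?_).symm
    refine Finset.prod_eq_zero (Finset.mem_univ i) ?_
    rw [(Finset.mem_filter.mp hx).2.2 _ _ hloop, hS.apply_diag]
  · generalize presentation (mergeEdges (closedSteps w)) w.dedup ex = K at hK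
    simp only [TreePresentation.check, Bool.and_eq_true, List.all_eq_true, Nat.beq_eq,
      List.contains_iff_mem, Nat.blt_eq, List.mem_range] at hK
    obtain ⟨⟨⟨⟨⟨⟨⟨⟨hpar, hlen⟩, hhead⟩, hmem⟩, hsurj⟩, hsE⟩, hEs⟩, hex⟩, hr⟩ := hK
    set n := K.parents.length with hn
    set l := w.map fun a => K.order.idxOf a with hl
    have hll : l.length = k := by simp [hl, hw]
    have hlget : ∀ i : Fin k, l.getD i 0 = K.order.idxOf (w.getD i 0) := fun i => by
      rw [List.getD_eq_getElem _ _ (by omega), List.getD_eq_getElem _ _ (by omega)]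
      simp [hl]
    have hwmem : ∀ i : Fin k, w.getD i 0 ∈ K.order := fun i => by
      rw [List.getD_eq_getElem _ _ (by omega)]
      exact hmem _ (List.getElem_mem _)
    have hllt : ∀ i : Fin k, l.getD i 0 < n + 1 := fun i => by
      rw [hlget, ← hlen]
      exact List.idxOf_lt_length_iff.mpr (hwmem i)
    have hlw : ∀ i j : Fin k, l.getD i 0 = l.getD j 0 ↔ w.getD i 0 = w.getD j 0 := fun i j => by
      rw [hlget, hlget]
      exact List.idxOf_inj (hwmem i)
    have hl0 : l.getD (0 : Fin k) 0 = 0 := by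
      rw [List.headD_eq_head?_getD, List.head?_eq_getElem?] at hhead
      simpa [List.getD] using hhead
    have hpos : ∀ t < n + 1, ∃ i : Fin k, l.getD i 0 = t := fun t ht => by
      obtain ⟨i, hi, rfl⟩ := List.getElem_of_mem (hsurj t ht)
      exact ⟨⟨i, hll ▸ hi⟩, List.getD_eq_getElem _ _ _⟩
    choose! pos hpos using hpos
    refine Attainable.congr (hrule K.parents K.extra hpar hex hr) fun N S hS v => ?_
    rw [treeSum_eq_sum S hpar]
    classical
    -- A placement of the tree vertices is the same as a walk that is constant on equal labels;
    -- `pos` selects a position for each vertex.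
    refine Finset.sum_nbij (fun z i => extendAt (fun _ => v) 1 z (l.getD i 0)) ?_ ?_ ?_ ?_
    · intro z _
      refine Finset.mem_filter.mpr ⟨Finset.mem_univ _, ?_, fun i j hij => ?_⟩
      · simp only [hl0]
        exact extendAt_of_lt _ (by omega) _
      · simp only [(hlw i j).mpr hij]
    · intro z _ z' _ hzz
      funext t
      have := congrFun hzz (pos (t + 1))
      simp only [hpos (t + 1) (by omega)] at this
      simpa [extendAt] using this
    · intro x hx
      obtain ⟨hx0, hx⟩ := (Finset.mem_filter.mp hx).2
      refine ⟨fun t => x (pos (t + 1)), Finset.mem_coe.mpr (Finset.mem_univ _), ?_⟩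
      funext i
      have hi := hllt i
      by_cases h0 : l.getD i 0 = 0
      · simp only [h0]
        rw [extendAt_of_lt _ (by omega), ← hx0]
        exact hx _ _ ((hlw _ _).mp (by rw [hl0, h0]))
      · simp only [extendAt]
        rw [dif_pos (by omega)]
        refine hx _ _ ((hlw _ _).mp ?_)
        rw [hpos _ (by omega)]
        omega
    · intro z _
      generalize extendAt (fun _ => v) 1 z = y
      -- The walk and the presentation use the same undirected edges, possibly with different
      -- multiplicities, which are irrelevant for entries in `{0, 1}`.
      rw [← edgeWeight_append, edgeWeight_eq_ite hS]
      split_ifs with h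
      · refine (Finset.prod_eq_one fun i _ => ?_).symm
        exact apply_eq_one_of_hasEdge hS h (hsE _ ((mem_closedSteps hll).mpr ⟨i, rfl⟩))
      · symm
        by_contra hne
        refine h fun e he => ?_
        refine apply_eq_one_of_hasEdge hS (fun f hf => ?_) (hEs e he)
        obtain ⟨i, rfl⟩ := (mem_closedSteps hll).mp hf
        exact (hS.zero_or_one _ _).resolve_left (Finset.prod_ne_zero_iff.mp hne i (Finset.mem_univ i))

theorem attainable_constrained_walks {L : SignalFunctional} {rule : List ℕ → List (ℕ × ℕ) → Bool}
    (hrule : SoundRule L rule) {k : ℕ} [NeZero k]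
    (h : (labelWords k).all (certified rule) = true) (t : Finset (Fin k × Fin k)) :
    Attainable L fun N S v => ∑ x : Fin k → Fin N with
      x 0 = v ∧ ∀ e ∈ t, x e.1 = x e.2, ∏ i, S (x i) (x (i + 1)) := by
  -- The constraints in `t` force equality exactly along the equivalence relation they generate, and
  -- a label word encodes its classes.
  let r : Setoid ℕ := Relation.EqvGen.setoid fun a b => ∃ e ∈ t, a = (e.1 : ℕ) ∧ b = (e.2 : ℕ)
  obtain ⟨w, hw, hlen, -, hwr⟩ := exists_labelWord r k
  refine (attainable_of_certified hrule hlen (List.all_eq_true.mp h w hw)).congr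
    fun N S _ v => ?_
  refine Finset.sum_congr (Finset.filter_congr fun x _ => and_congr_right fun _ => ?_) fun _ _ => rfl
  constructor
  · intro hx e he
    exact hx _ _ ((hwr _ e.1.2 _ e.2.2).mpr (.rel _ _ ⟨e, he, rfl, rfl⟩))
  · intro hx i j hij
    have key : ∀ a b, r a b → x (Fin.ofNat k a) = x (Fin.ofNat k b) := by
      intro a b hab
      induction hab with
      | rel a b h =>
        obtain ⟨e, he, rfl, rfl⟩ := h
        simpa using hx e he
      | refl => rfl
      | symm _ _ _ ih => exact ih.symm
      | trans _ _ _ _ _ ih ih' => exact ih.trans ih'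
    simpa using key i j ((hwr _ i.2 _ j.2).mp hij)

/-- Inclusion-exclusion over the pairs of positions at which a closed walk coincides. -/
theorem attainable_injective_walks {L : SignalFunctional} {rule : List ℕ → List (ℕ × ℕ) → Bool}
    (hrule : SoundRule L rule) {k : ℕ} [NeZero k]
    (h : (labelWords k).all (certified rule) = true) :
    Attainable L fun N S v => ∑ x : Fin k → Fin N with
      x 0 = v ∧ Function.Injective x, ∏ i, S (x i) (x (i + 1)) := by
  let pairs : Finset (Fin k × Fin k) := Finset.univ.filter fun e => e.1 ≠ e.2
  refine (attainable_sum pairs.powerset fun t _ =>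
    (attainable_constrained_walks hrule h t).smul ((-1) ^ t.card)).congr fun N S _ v => ?_
  simp only [Finset.sum_filter, Finset.mul_sum]
  rw [Finset.sum_comm]
  refine Finset.sum_congr rfl fun x _ => ?_
  by_cases hv : x 0 = v
  · have expand : ∑ t ∈ pairs.powerset, (-1 : ℝ) ^ t.card *
        (if ∀ e ∈ t, x e.1 = x e.2 then 1 else 0) = if Function.Injective x then 1 else 0 := by
      have e₁ : ∀ t : Finset (Fin k × Fin k), (-1 : ℝ) ^ t.card *
          (if ∀ e ∈ t, x e.1 = x e.2 then 1 else 0) =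
          ∏ e ∈ t, -(if x e.1 = x e.2 then (1 : ℝ) else 0) := fun t => by
        rw [Finset.prod_neg, Finset.prod_ite_zero]
        simp
      simp only [e₁]
      rw [← Finset.prod_one_add]
      split_ifs with hinj
      · refine Finset.prod_eq_one fun e he => ?_
        rw [if_neg fun h => (Finset.mem_filter.mp he).2 (hinj h)]
        simp
      · obtain ⟨i, j, hij, hne⟩ : ∃ i j, x i = x j ∧ i ≠ j := by
          simpa [Function.Injective] using hinj
        refine Finset.prod_eq_zero (i := (i, j)) (by simp [pairs, hne]) ?_
        simp [hij]
    have e₂ := congrArg (· * ∏ i, S (x i) (x (i + 1))) expand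
    simp only [Finset.sum_mul, mul_assoc, ite_mul, one_mul, zero_mul] at e₂
    simpa [hv] using e₂
  · simp [hv]

/-! ### Cycles as injective closed walks -/

theorem Fin.forall_of_add_one {n : ℕ} {p : Fin (n + 1) → Prop} (h₀ : p 0)
    (h : ∀ i, p i → p (i + 1)) (i : Fin (n + 1)) : p i := by
  induction i using Fin.induction with
  | zero => exact h₀
  | succ i ih => simpa using h _ ih

theorem Fin.one_add_one_ne_zero {n : ℕ} : (1 + 1 : Fin (n + 3)) ≠ 0 := by
  intro h
  have := congrArg Fin.val h
  simp only [Fin.val_add, Fin.val_one, Fin.val_zero] at this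
  rw [Nat.mod_eq_of_lt (by omega)] at this
  omega

section cycles

variable {V : Type*} (G : SimpleGraph V) {n : ℕ}

/-- The subgraph traced out by a closed walk. -/
def closedWalkSubgraph (x : Fin (n + 3) → V) : G.Subgraph where
  verts := Set.range x
  Adj a b := G.Adj a b ∧ ∃ i, (x i = a ∧ x (i + 1) = b) ∨ (x i = b ∧ x (i + 1) = a)
  adj_sub h := h.1
  edge_vert := by
    rintro a b ⟨-, i, ⟨rfl, -⟩ | ⟨-, rfl⟩⟩
    exacts [⟨i, rfl⟩, ⟨i + 1, rfl⟩]
  symm := ⟨fun _ _ h => ⟨h.1.symm, h.2.imp fun _ h => h.symm⟩⟩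

/-- An injective walk around a cycle graph has constant direction. -/
theorem eq_add_or_eq_sub_of_injective {y : Fin (n + 3) → Fin (n + 3)}
    (hy : Function.Injective y) (hadj : ∀ i, y (i + 1) = y i + 1 ∨ y (i + 1) = y i - 1) :
    (∀ i, y i = y 0 + i) ∨ ∀ i, y i = y 0 - i := by
  have hne : ∀ i : Fin (n + 3), i + 1 + 1 ≠ i := fun i h =>
    Fin.one_add_one_ne_zero (n := n) (by rwa [add_assoc, add_eq_left] at h)
  rcases hadj 0 with h | h
  · have step : ∀ i, y (i + 1) = y i + 1 := by
      refine Fin.forall_of_add_one h fun i hi => (hadj (i + 1)).resolve_right fun h' => ?_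
      rw [hi, add_sub_cancel_right] at h'
      exact hne i (hy h')
    exact .inl (Fin.forall_of_add_one (by simp) fun i hi => by rw [step, hi, add_assoc])
  · have step : ∀ i, y (i + 1) = y i - 1 := by
      refine Fin.forall_of_add_one h fun i hi => (hadj (i + 1)).resolve_left fun h' => ?_
      rw [hi, sub_add_cancel] at h'
      exact hne i (hy h')
    exact .inr (Fin.forall_of_add_one (by simp) fun i hi => by rw [step, hi, sub_sub])

variable {G}

theorem nonempty_iso_closedWalkSubgraph {x : Fin (n + 3) → V} (hx : Function.Injective x)
    (hadj : ∀ i, G.Adj (x i) (x (i + 1))) :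
    Nonempty ((closedWalkSubgraph G x).coe ≃g SimpleGraph.cycleGraph (n + 3)) := by
  let φ : Fin (n + 3) ≃ (closedWalkSubgraph G x).verts := Equiv.ofInjective x hx
  refine ⟨RelIso.symm ⟨φ, fun {a b} => ?_⟩⟩
  rw [SimpleGraph.cycleGraph_adj]
  change (G.Adj (x a) (x b) ∧ ∃ i, (x i = x a ∧ x (i + 1) = x b) ∨ (x i = x b ∧ x (i + 1) = x a)) ↔ _
  constructor
  · rintro ⟨-, i, ⟨h, h'⟩ | ⟨h, h'⟩⟩
    · right
      rw [← hx h, ← hx h']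
      simp
    · left
      rw [← hx h, ← hx h']
      simp
  · rintro (h | h)
    · obtain rfl : a = b + 1 := by rw [← h]; simp
      exact ⟨(hadj b).symm, b, .inr ⟨rfl, rfl⟩⟩
    · obtain rfl : b = a + 1 := by rw [← h]; simp
      exact ⟨hadj a, a, .inl ⟨rfl, rfl⟩⟩

theorem closedWalkSubgraph_of_iso {C : G.Subgraph}
    (ψ : C.coe ≃g SimpleGraph.cycleGraph (n + 3)) (y : Fin (n + 3) ≃ Fin (n + 3))
    (hy : (∀ i, y (i + 1) = y i + 1) ∨ ∀ i, y (i + 1) = y i - 1) :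
    closedWalkSubgraph G (fun i => (ψ.symm (y i) : V)) = C := by
  have hadj : ∀ i, C.Adj (ψ.symm (y i)) (ψ.symm (y (i + 1))) := fun i => by
    have : C.coe.Adj (ψ.symm (y i)) (ψ.symm (y (i + 1))) := by
      rw [ψ.symm.map_adj_iff, SimpleGraph.cycleGraph_adj]
      rcases hy with h | h <;> simp [h]
    exact this
  have hsurj : ∀ p : Fin (n + 3), ∃ i, y i = p := y.surjective
  refine SimpleGraph.Subgraph.ext ?_ ?_
  · ext a
    constructor
    · rintro ⟨i, rfl⟩
      exact (ψ.symm (y i)).2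
    · intro ha
      exact ⟨y.symm (ψ ⟨a, ha⟩), by simp⟩
  · funext a b
    refine propext ⟨?_, fun h => ⟨h.adj_sub, ?_⟩⟩
    · rintro ⟨-, i, ⟨rfl, rfl⟩ | ⟨rfl, rfl⟩⟩
      exacts [hadj i, (hadj i).symm]
    · have hψ : (SimpleGraph.cycleGraph (n + 3)).Adj (ψ ⟨a, h.fst_mem⟩) (ψ ⟨b, h.snd_mem⟩) :=
        ψ.map_adj_iff.mpr h
      have ea : (ψ.symm (ψ ⟨a, h.fst_mem⟩) : V) = a := by simp
      have eb : (ψ.symm (ψ ⟨b, h.snd_mem⟩) : V) = b := by simp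
      generalize ψ ⟨a, h.fst_mem⟩ = p at hψ ea
      generalize ψ ⟨b, h.snd_mem⟩ = q at hψ eb
      obtain ⟨i, rfl⟩ := hsurj p
      obtain ⟨j, rfl⟩ := hsurj q
      rw [SimpleGraph.cycleGraph_adj, sub_eq_iff_eq_add', sub_eq_iff_eq_add'] at hψ
      subst ea eb
      rcases hy with hy | hy
      · rcases hψ with hψ | hψ
        · exact ⟨j, .inr ⟨rfl, by simp only [hy, hψ]⟩⟩
        · exact ⟨i, .inl ⟨rfl, by simp only [hy, hψ]⟩⟩
      · rcases hψ with hψ | hψ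
        · exact ⟨i, .inl ⟨rfl, by simp only [hy, hψ, add_sub_cancel_right]⟩⟩
        · exact ⟨j, .inr ⟨rfl, by simp only [hy, hψ, add_sub_cancel_right]⟩⟩

/-- Every cycle through `v` is traced out by exactly two injective closed walks from `v`. -/
theorem two_mul_cycleCount [Fintype V] [DecidableEq V] [DecidableRel G.Adj] (v : V) :
    2 * cycleCount G (n + 3) v = (Finset.univ.filter fun x : Fin (n + 3) → V =>
      x 0 = v ∧ Function.Injective x ∧ ∀ i, G.Adj (x i) (x (i + 1))).card := by
  classical
  have : Fintype G.Subgraph := Fintype.ofFinite _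
  rw [cycleCount, Set.ncard_eq_toFinset_card', Set.toFinset_ofPred,
    Finset.card_eq_sum_card_fiberwise (f := closedWalkSubgraph G)
      (t := {C | v ∈ C.verts ∧ Nonempty (C.coe ≃g SimpleGraph.cycleGraph (n + 3))}),
    Finset.sum_const_nat (m := 2), mul_comm]
  · intro C hC
    obtain ⟨hv, ⟨ψ⟩⟩ := (Finset.mem_filter.mp hC).2
    let x₁ : Fin (n + 3) → V := fun i => ψ.symm (ψ ⟨v, hv⟩ + i)
    let x₂ : Fin (n + 3) → V := fun i => ψ.symm (ψ ⟨v, hv⟩ - i)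
    have e₁ : closedWalkSubgraph G x₁ = C :=
      closedWalkSubgraph_of_iso ψ (Equiv.addLeft (ψ ⟨v, hv⟩)) (.inl fun i => by simp [add_assoc])
    have e₂ : closedWalkSubgraph G x₂ = C :=
      closedWalkSubgraph_of_iso ψ (Equiv.subLeft (ψ ⟨v, hv⟩)) (.inr fun i => by simp [sub_sub])
    have adj : ∀ p q : Fin (n + 3), p - q = 1 ∨ q - p = 1 → G.Adj (ψ.symm p) (ψ.symm q) := by
      intro p q h
      have : C.coe.Adj (ψ.symm p) (ψ.symm q) := by
        rw [ψ.symm.map_adj_iff, SimpleGraph.cycleGraph_adj]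
        exact h
      exact this.adj_sub
    -- The two directions differ at position `1`, since `1 ≠ -1` modulo `n + 3`.
    have hne : x₁ ≠ x₂ := by
      intro h
      have h := ψ.symm.injective (Subtype.ext (congrFun h 1))
      refine Fin.one_add_one_ne_zero (n := n) ?_
      have h' : (1 : Fin (n + 3)) = -1 := by simpa [sub_eq_add_neg] using h
      nth_rewrite 1 [h']
      simp
    refine Eq.trans ?_ (Finset.card_pair hne)
    congr 1
    ext x
    simp only [Finset.mem_filter, Finset.mem_univ, true_and, Finset.mem_insert,
      Finset.mem_singleton]
    constructor
    · rintro ⟨⟨hx0, hinj, hadj⟩, rfl⟩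
      have hmem : ∀ i, x i ∈ (closedWalkSubgraph G x).verts := fun i => ⟨i, rfl⟩
      have hy := eq_add_or_eq_sub_of_injective (y := fun i => ψ ⟨x i, hmem i⟩)
        (fun i j h => hinj (Subtype.ext_iff.mp (ψ.injective h))) fun i => by
          have h : (closedWalkSubgraph G x).coe.Adj ⟨x i, hmem i⟩ ⟨x (i + 1), hmem (i + 1)⟩ :=
            ⟨hadj i, i, .inl ⟨rfl, rfl⟩⟩
          rw [← ψ.map_adj_iff, SimpleGraph.cycleGraph_adj] at h
          exact h.symm.imp sub_eq_iff_eq_add'.mp fun h => eq_sub_of_add_eq (sub_eq_iff_eq_add'.mp h).symm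
      subst hx0
      refine hy.imp (fun hy => ?_) fun hy => ?_
      · funext i
        simp only [x₁, ← hy i]
        simp
      · funext i
        simp only [x₂, ← hy i]
        simp
    · rintro (rfl | rfl)
      · exact ⟨⟨by simp [x₁], fun i j h => by
          simpa using ψ.symm.injective (Subtype.ext h), fun i => adj _ _ (.inr (by simp))⟩, e₁⟩
      · exact ⟨⟨by simp [x₂], fun i j h => by
          simpa using ψ.symm.injective (Subtype.ext h), fun i => adj _ _ (.inl (by simp))⟩, e₂⟩
  · intro x hx
    obtain ⟨hx0, hinj, hadj⟩ := (Finset.mem_filter.mp hx).2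
    simp only [Finset.coe_filter, Finset.mem_univ, true_and, Set.mem_ofPred_eq]
    exact ⟨⟨0, hx0⟩, nonempty_iso_closedWalkSubgraph hinj hadj⟩

end cycles

/-! ### The finite check and the conclusion -/

theorem all_certified_pairRule :
    ∀ j : Fin 5, (labelWords ((j : ℕ) + 3)).all (certified pairRule) = true := by
  decide +kernel

theorem all_certified_starRule :
    ∀ j : Fin 5, (labelWords ((j : ℕ) + 3)).all (certified starRule) = true := by
  decide +kernel

theorem exists_nodeProg_cycleCount {L : SignalFunctional}
    {rule : List ℕ → List (ℕ × ℕ) → Bool} (hrule : SoundRule L rule) {n : ℕ}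
    (h : (labelWords (n + 3)).all (certified rule) = true) :
    ∃ P : NodeProg, ∀ (N : ℕ) (G : SimpleGraph (Fin N)) [DecidableRel G.Adj] (v : Fin N),
      L N (P.eval (G.adjMatrix ℝ) MvPolynomial.X v) = cycleCount G (n + 3) v := by
  obtain ⟨P, hP⟩ := (attainable_injective_walks hrule h).smul (1 / 2)
  refine ⟨P, fun N G _ v => ?_⟩
  rw [hP N _ (G.isAdjMatrix_adjMatrix ℝ) v]
  have h2 : (2 : ℝ) * cycleCount G (n + 3) v = ∑ x : Fin (n + 3) → Fin N with
      x 0 = v ∧ Function.Injective x, ∏ i, G.adjMatrix ℝ (x i) (x (i + 1)) := by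
    have := two_mul_cycleCount (G := G) (n := n) v
    rw [← Nat.cast_ofNat, ← Nat.cast_mul, this, Finset.card_filter, Finset.sum_filter]
    push_cast
    refine Finset.sum_congr rfl fun x _ => ?_
    simp only [SimpleGraph.adjMatrix_apply, Finset.prod_ite_zero, Finset.mem_univ, true_imp_iff,
      Finset.prod_const_one, ← ite_and, and_assoc]
  simp only [← h2]
  ring

theorem NodeProg.aeval_eval_X {N : ℕ} (S : Matrix (Fin N) (Fin N) ℝ) (x : Fin N → ℝ)
    (P : NodeProg) (v : Fin N) :
    MvPolynomial.aeval x (P.eval S (MvPolynomial.X (R := ℝ)) v) = P.eval S x v := by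
  rw [NodeProg.map_eval]
  simp

/-- The joint law is the product measure, so each monomial is integrable and its mean factors into
moments. -/
theorem integrable_and_integral_aeval {μ : Measure ℝ} [IsProbabilityMeasure μ]
    (hμ : ∀ n : ℕ, Integrable (fun x : ℝ => x ^ n) μ) {N : ℕ} {Ω : Type*} [MeasurableSpace Ω]
    {P : Measure Ω} [IsProbabilityMeasure P] {q : Fin N → Ω → ℝ} (hq : ∀ i, HasLaw (q i) μ P)
    (hind : iIndepFun q P) (p : MvPolynomial (Fin N) ℝ) :
    Integrable (fun ω => MvPolynomial.aeval (fun i => q i ω) p) P ∧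
    ∫ ω, MvPolynomial.aeval (fun i => q i ω) p ∂P =
      momentFunctional (fun n => ∫ x, x ^ n ∂μ) N p := by
  have hlaw : HasLaw (fun ω i => q i ω) (Measure.pi fun _ => μ) P := hind.hasLaw_pi hq
  induction p using MvPolynomial.induction_on' with
  | monomial s c =>
    have hint : Integrable (fun x : Fin N → ℝ => ∏ i, x i ^ s i) (Measure.pi fun _ => μ) :=
      Integrable.fintype_prod fun i => hμ (s i)
    have heq : ∀ ω, MvPolynomial.aeval (fun i => q i ω) (MvPolynomial.monomial s c) =
        c * ∏ i, q i ω ^ s i := fun ω => by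
      rw [MvPolynomial.aeval_monomial, Finsupp.prod_fintype _ _ fun _ => pow_zero _]
      rfl
    simp only [heq]
    have hint' : Integrable (fun ω => ∏ i, q i ω ^ s i) P := by
      rw [← hlaw.map_eq] at hint
      exact hint.comp_aemeasurable hlaw.aemeasurable
    refine ⟨hint'.const_mul c, ?_⟩
    rw [integral_const_mul, momentFunctional_monomial]
    congr 1
    rw [← integral_fintype_prod_eq_prod]
    exact hlaw.integral_comp hint.aestronglyMeasurable
  | add p p' hp hp' =>
    simp only [map_add]
    exact ⟨hp.1.add hp'.1, by rw [integral_add hp.1 hp'.1, hp.2, hp'.2]⟩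

theorem mainTheorem4 (p : ℕ) (hp : 2 ≤ p) :
    (∀ μ : Measure ℝ, IsProbabilityMeasure μ →
      (∀ n : ℕ, Integrable (fun x : ℝ => x ^ n) μ) →
      ∫ x, x ∂μ = 0 → ∫ x, x ^ 2 ∂μ = 1 →
      ∃ Φ : GNN p 1 5,
        ∀ (N : ℕ) (G : SimpleGraph (Fin N)) [DecidableRel G.Adj]
          (Ω : Type*) [MeasurableSpace Ω] (P : Measure Ω) (q : Fin N → Ω → ℝ),
          (∀ i, HasLaw (q i) μ P) → iIndepFun q P →
          ∀ (v : Fin N) (j : Fin 5),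
            Integrable (fun ω => Φ.run G (fun i => q i ω) v j) P ∧
            ∫ ω, Φ.run G (fun i => q i ω) v j ∂P = (cycleCount G ((j : ℕ) + 3) v : ℝ)) ∧
    (∃ Ψ : GNN p 1 5,
      ∀ (N : ℕ) (G : SimpleGraph (Fin N)) [DecidableRel G.Adj] (v : Fin N) (j : Fin 5),
        ∑ m : Fin N, Ψ.run G (Pi.single m 1) v j = (cycleCount G ((j : ℕ) + 3) v : ℝ)) := by
  constructor
  · intro μ _ hμ hmean hvar
    have hM : IsStandardized fun n => ∫ x, x ^ n ∂μ := ⟨by simp, by simpa using hmean, hvar⟩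
    choose Q hQ using fun j : Fin 5 =>
      exists_nodeProg_cycleCount (soundRule_pairRule hM) (all_certified_pairRule j)
    obtain ⟨Φ, hΦ⟩ := realizable_of_two_le hp Q
    refine ⟨Φ, fun N G _ Ω _ P q hq hind v j => ?_⟩
    have := (hq v).isProbabilityMeasure
    have key := integrable_and_integral_aeval hμ hq hind
      ((Q j).eval (G.adjMatrix ℝ) MvPolynomial.X v)
    simp only [NodeProg.aeval_eval_X, hQ] at key
    simpa only [GNN.run, hΦ] using key
  · choose Q hQ using fun j : Fin 5 =>
      exists_nodeProg_cycleCount soundRule_starRule (all_certified_starRule j)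
    obtain ⟨Ψ, hΨ⟩ := realizable_of_two_le hp Q
    refine ⟨Ψ, fun N G _ v j => ?_⟩
    simp only [GNN.run, hΨ, ← hQ, basisFunctional_apply, NodeProg.aeval_eval_X]
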